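/- **Setting.** Let $X,Y$ be compact Polish spaces with finite Borel measures $\mu_X,\mu_Y$, and let $\omega_X:X\times X\to[0,\infty)$, $\omega_Y:Y\times Y\to[0,\infty)$ be bounded measurable kernels, so that $(X,\mu_X,\omega_X)$ and $(Y,\mu_Y,\omega_Y)$ are measure networks. Let $\Gamma(\mu_X,\mu_Y)$ be the set of semi-couplings, i.e. pairs $(\gamma_0,\gamma_1)$ of positive Radon measures on $X\times Y$ such that the first marginal of $\gamma_0$ is $\mu_X$ and the second marginal of $\gamma_1$ is $\mu_Y$; it carries the topology of weak convergence of both components. Let $\Omega:[0,\infty)\to[0,1]$ satisfy $\Omega(0)=1$, $\Omega(z)<1$ for $z>0$, and $\Omega(z+w)\le\Omega(z)\Omega(w)$ for all $z,w\ge0$. For $\delta>0$ define the cone distance on $(\mathbb R\times[0,\infty))/(\mathbb R\times\{0\})$ by $$\mathsf d_\delta([u,r],[v,s])^2=4\delta^2\Big(r^2+s^2-2rs\,\Omega\Big(\tfrac{|u-v|}{2\delta}\Big)\Big)$$ and the loss $$\mathbf H_\delta(\gamma_0,\gamma_1)=\int_{(X\times Y)^2}\mathsf d_\delta\Big(\big[\omega_X(x,x'),\sqrt{f_0(x,y)f_0(x',y')}\big],\big[\omega_Y(y,y'),\sqrt{f_1(x,y)f_1(x',y')}\big]\Big)^2\,d\gamma(x,y)\,d\gamma(x',y'),$$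 where $f_i=\frac{d\gamma_i}{d\gamma}$ and $\gamma$ is any $\sigma$-finite measure on $X\times Y$ with $\gamma_0,\gamma_1\ll\gamma$ (the value does not depend on $\gamma$). Put $$\widehat{\mathbf H}_\delta(\gamma_0,\gamma_1)=\mathbf H_\delta(\gamma_0,\gamma_1)-4\delta^2\big(\mu_X(X)-\mu_Y(Y)\big)^2 .$$ **Assumption.** There are constants $C,C'\ge0$, $a_1>0$ and $M$ such that $|\omega_X(x,x')-\omega_Y(y,y')|\le M$ for all $x,x'\in X$, $y,y'\in Y$, and $$\Omega(z)\ge 1-Cz^2\ \text{ for all } z\ge0,\qquad \Omega(z)\le 1-Cz^2+C'z^4\ \text{ for all } z\in[0,M/a_1].$$ **Limit functional.** Define $\mathbf H_\infty:\Gamma(\mu_X,\mu_Y)\to\mathbb R\cup\{\infty\}$ as follows. * If $\gamma_0=0$ or $\gamma_1=0$ (equivalently $\mu_X=0$ or $\mu_Y=0$), then $\mathbf H_\infty(\gamma_0,\gamma_1)=0$. * Otherwise, if $\gamma_1=\alpha\gamma_0$ with $\alpha=\mu_Y(Y)/\mu_X(X)$, then $$\mathbf H_\infty(\gamma_0,\gamma_1)=2C\alpha\int_{(X\times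 Y)^2}|\omega_X(x,x')-\omega_Y(y,y')|^2\,d\gamma_0(x,y)\,d\gamma_0(x',y').$$ * In all other cases $\mathbf H_\infty(\gamma_0,\gamma_1)=+\infty$. **Theorem.** $\widehat{\mathbf H}_\delta$ $\Gamma$-converges to $\mathbf H_\infty$ as $\delta\to\infty$. That is, for every sequence $\delta_n>0$ with $\delta_n\to\infty$ and every $u\in\Gamma(\mu_X,\mu_Y)$: 1. for every sequence $u_n\to u$ in $\Gamma(\mu_X,\mu_Y)$, $\ \mathbf H_\infty(u)\le\liminf_{n\to\infty}\widehat{\mathbf H}_{\delta_n}(u_n)$; 2. there is a sequence $u_n\to u$ in $\Gamma(\mu_X,\mu_Y)$ with $\ \limsup_{n\to\infty}\widehat{\mathbf H}_{\delta_n}(u_n)\le\mathbf H_\infty(u)$. -/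

import Mathlib

open MeasureTheory Filter Topology
open scoped NNReal ENNReal

noncomputable section

/-! ### Cones -/

/-- The axioms on the function `Ω : [0, ∞) → [0, 1]` that defines a cone distance (only the values
of `Ω` on `[0, ∞)` are constrained, and only these values are ever used). -/
structure IsConeFunction (Ω : ℝ → ℝ) : Prop where
  mem_unit : ∀ z, 0 ≤ z → 0 ≤ Ω z ∧ Ω z ≤ 1
  map_zero : Ω 0 = 1
  lt_one : ∀ z, 0 < z → Ω z < 1
  map_add_le : ∀ z w, 0 ≤ z → 0 ≤ w → Ω (z + w) ≤ Ω z * Ω w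

/-- The relation on `X × [0, ∞)` that collapses `X × {0}` to one point. -/
def coneSetoid (X : Type*) : Setoid (X × ℝ≥0) where
  r p q := p = q ∨ (p.2 = 0 ∧ q.2 = 0)
  iseqv :=
    { refl := fun _ => Or.inl rfl
      symm := by
        rintro p q (h | ⟨h, h'⟩)
        · exact Or.inl h.symm
        · exact Or.inr ⟨h', h⟩
      trans := by
        rintro p q r (rfl | ⟨h, h'⟩) (rfl | ⟨k, k'⟩)
        · exact Or.inl rfl
        · exact Or.inr ⟨k, k'⟩
        · exact Or.inr ⟨h, h'⟩
        · exact Or.inr ⟨h, k'⟩ }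

/-- The cone `(X × [0, ∞)) / (X × {0})`. -/
def Cone (X : Type*) : Type _ := Quotient (coneSetoid X)

/-- The point `[x, r]` of the cone. -/
def Cone.mk {X : Type*} (x : X) (r : ℝ≥0) : Cone X := Quotient.mk (coneSetoid X) (x, r)

/-- The cone distance with parameter `δ`:
`d([x, r], [y, s])² = 4 δ² (r² + s² - 2 r s Ω(d(x, y) / (2 δ)))`. -/
def coneDist {X : Type*} [MetricSpace X] (Ω : ℝ → ℝ) (δ : ℝ) : Cone X → Cone X → ℝ :=
  Quotient.lift₂
    (fun p q : X × ℝ≥0 =>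
      √(4 * δ ^ 2 * ((p.2 : ℝ) ^ 2 + (q.2 : ℝ) ^ 2
        - 2 * (p.2 : ℝ) * (q.2 : ℝ) * Ω (dist p.1 q.1 / (2 * δ)))))
    (by
      rintro p q p' q' (rfl | ⟨h, h'⟩) (rfl | ⟨k, k'⟩) <;> simp_all)

/-- For a function satisfying the axioms, the square of the cone distance is given by the
defining formula (the square root is taken of a nonnegative number). -/
theorem coneDist_sq {X : Type*} [MetricSpace X] {Ω : ℝ → ℝ} (hΩ : IsConeFunction Ω) {δ : ℝ}
    (hδ : 0 < δ) (x y : X) (r s : ℝ≥0) :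
    coneDist Ω δ (Cone.mk x r) (Cone.mk y s) ^ 2 =
      4 * δ ^ 2 * ((r : ℝ) ^ 2 + (s : ℝ) ^ 2 - 2 * (r : ℝ) * (s : ℝ) * Ω (dist x y / (2 * δ))) := by
  have h := (hΩ.mem_unit (dist x y / (2 * δ)) (by positivity)).2
  have hrs : (0 : ℝ) ≤ (r : ℝ) * (s : ℝ) := by positivity
  refine Real.sq_sqrt (mul_nonneg (by positivity) ?_)
  show (0 : ℝ) ≤ (r : ℝ) ^ 2 + (s : ℝ) ^ 2 - 2 * (r : ℝ) * (s : ℝ) * Ω (dist x y / (2 * δ))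
  nlinarith [sq_nonneg ((r : ℝ) - s), mul_le_mul_of_nonneg_left h hrs]

/-! ### Measure networks and semi-couplings -/

/-- A measure network: a compact Polish space with a finite Borel measure (which is automatically
Radon) and a bounded measurable kernel with values in `[0, ∞)`. -/
structure MeasureNetwork (X : Type*) [TopologicalSpace X] [CompactSpace X] [PolishSpace X]
    [MeasurableSpace X] [BorelSpace X] where
  μ : FiniteMeasure X
  ω : X → X → ℝ≥0
  measurable_ω : Measurable fun p : X × X => ω p.1 p.2
  bounded_ω : ∃ B : ℝ≥0, ∀ x x', ω x x' ≤ B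

/-- The semi-couplings from `μ` to `ν`: pairs `(γ₀, γ₁)` of measures on `X × Y` such that the first
marginal of `γ₀` is `μ` and the second marginal of `γ₁` is `ν`. (Such measures are finite since `μ`
and `ν` are.) As a subspace of `FiniteMeasure (X × Y) × FiniteMeasure (X × Y)` it
carries the topology of weak convergence of both components. -/
def SemiCouplings {X Y : Type*} [MeasurableSpace X] [MeasurableSpace Y]
    (μ : FiniteMeasure X) (ν : FiniteMeasure Y) :
    Set (FiniteMeasure (X × Y) × FiniteMeasure (X × Y)) :=
  {γ | γ.1.map Prod.fst = μ ∧ γ.2.map Prod.snd = ν}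

/-! ### The conic Gromov-Wasserstein loss -/

/-- The loss of a pair `(γ₀, γ₁)`, computed with the reference measure `γ`: the integral over
`((x, y), (x', y'))`, against `γ ⊗ γ`, of the squared cone distance on the cone over `ℝ` between
`[ωX(x, x'), √(dγ₀/dγ(x, y) · dγ₀/dγ(x', y'))]` and
`[ωY(y, y'), √(dγ₁/dγ(x, y) · dγ₁/dγ(x', y'))]`. -/
def cgwLossWith {X Y : Type*} [MeasurableSpace X] [MeasurableSpace Y]
    (Ω : ℝ → ℝ) (δ : ℝ) (ωX : X → X → ℝ≥0) (ωY : Y → Y → ℝ≥0)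
    (γ₀ γ₁ γ : Measure (X × Y)) : ℝ :=
  ∫ p : (X × Y) × (X × Y),
    coneDist Ω δ
      (Cone.mk (ωX p.1.1 p.2.1 : ℝ)
        (NNReal.sqrt ((γ₀.rnDeriv γ p.1).toNNReal * (γ₀.rnDeriv γ p.2).toNNReal)))
      (Cone.mk (ωY p.1.2 p.2.2 : ℝ)
        (NNReal.sqrt ((γ₁.rnDeriv γ p.1).toNNReal * (γ₁.rnDeriv γ p.2).toNNReal))) ^ 2
    ∂(γ.prod γ)

/-- The loss `H_δ(γ₀, γ₁)`, computed with the reference measure `γ₀ + γ₁`; see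
`cgwLossWith_eq_cgwLoss` for the independence of the reference measure. -/
def cgwLoss {X Y : Type*} [MeasurableSpace X] [MeasurableSpace Y]
    (Ω : ℝ → ℝ) (δ : ℝ) (ωX : X → X → ℝ≥0) (ωY : Y → Y → ℝ≥0)
    (γ₀ γ₁ : FiniteMeasure (X × Y)) : ℝ :=
  cgwLossWith Ω δ ωX ωY γ₀ γ₁ ((γ₀ : Measure (X × Y)) + γ₁)

theorem coneDist_sq_mul {Ω : ℝ → ℝ} (hΩ : IsConeFunction Ω) {δ : ℝ} (hδ : 0 < δ) (u v : ℝ)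
    (a b k : ℝ≥0) :
    coneDist Ω δ (Cone.mk u (NNReal.sqrt (k * a))) (Cone.mk v (NNReal.sqrt (k * b))) ^ 2
      = k * coneDist Ω δ (Cone.mk u (NNReal.sqrt a)) (Cone.mk v (NNReal.sqrt b)) ^ 2 := by
  rw [coneDist_sq hΩ hδ, coneDist_sq hΩ hδ, NNReal.sqrt_mul, NNReal.sqrt_mul]
  have hk : ((NNReal.sqrt k : ℝ≥0) : ℝ) ^ 2 = k := by
    exact_mod_cast NNReal.sq_sqrt k
  push_cast
  rw [Real.coe_sqrt] at hk
  linear_combination (4 * δ ^ 2 * (√(a : ℝ) ^ 2 + √(b : ℝ) ^ 2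
    - 2 * √(a : ℝ) * √(b : ℝ) * Ω (dist u v / (2 * δ)))) * hk

/-- The loss may be computed with any σ-finite reference measure `γ` that dominates `γ₀` and
`γ₁`. -/
theorem cgwLossWith_eq_cgwLoss {X Y : Type*} [MeasurableSpace X] [MeasurableSpace Y]
    {Ω : ℝ → ℝ} (hΩ : IsConeFunction Ω) {δ : ℝ} (hδ : 0 < δ)
    (ωX : X → X → ℝ≥0) (ωY : Y → Y → ℝ≥0) (γ₀ γ₁ : FiniteMeasure (X × Y))
    (γ : Measure (X × Y)) [SigmaFinite γ]
    (h₀ : (γ₀ : Measure (X × Y)) ≪ γ) (h₁ : (γ₁ : Measure (X × Y)) ≪ γ) :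
    cgwLossWith Ω δ ωX ωY γ₀ γ₁ γ = cgwLoss Ω δ ωX ωY γ₀ γ₁ := by
  set σ : Measure (X × Y) := (γ₀ : Measure (X × Y)) + γ₁ with hσ
  have hσγ : σ ≪ γ := h₀.add_left h₁
  have e₀ : (γ₀ : Measure (X × Y)) ≪ σ :=
    Measure.absolutelyContinuous_of_le (Measure.le_add_right le_rfl)
  have e₁ : (γ₁ : Measure (X × Y)) ≪ σ :=
    Measure.absolutelyContinuous_of_le (Measure.le_add_left le_rfl)
  set k : X × Y → ℝ≥0∞ := σ.rnDeriv γ with hk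
  have hkm : Measurable k := Measure.measurable_rnDeriv _ _
  have hkd : γ.withDensity k = σ := Measure.withDensity_rnDeriv_eq _ _ hσγ
  have c₀ : ∀ᵐ p ∂γ, (γ₀ : Measure (X × Y)).rnDeriv σ p * k p
      = (γ₀ : Measure (X × Y)).rnDeriv γ p := Measure.rnDeriv_mul_rnDeriv e₀
  have c₁ : ∀ᵐ p ∂γ, (γ₁ : Measure (X × Y)).rnDeriv σ p * k p
      = (γ₁ : Measure (X × Y)).rnDeriv γ p := Measure.rnDeriv_mul_rnDeriv e₁
  have hfin : ∀ᵐ p ∂γ, k p < ∞ := Measure.rnDeriv_lt_top _ _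
  have hprod : σ.prod σ
      = (γ.prod γ).withDensity fun p : (X × Y) × (X × Y) => k p.1 * k p.2 := by
    have := prod_withDensity (μ := γ) (ν := γ) hkm hkm
    rw [← this, hkd]
  have hlt : ∀ᵐ p : (X × Y) × (X × Y) ∂(γ.prod γ), k p.1 * k p.2 < ∞ := by
    filter_upwards [Measure.quasiMeasurePreserving_fst.ae hfin,
      Measure.quasiMeasurePreserving_snd.ae hfin] with p hp hq
    exact ENNReal.mul_lt_top hp hq
  unfold cgwLoss
  unfold cgwLossWith
  rw [← hσ, hprod, integral_withDensity_eq_integral_toReal_smul (by fun_prop) hlt]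
  refine integral_congr_ae ?_
  filter_upwards [Measure.quasiMeasurePreserving_fst.ae c₀,
    Measure.quasiMeasurePreserving_snd.ae c₀, Measure.quasiMeasurePreserving_fst.ae c₁,
    Measure.quasiMeasurePreserving_snd.ae c₁] with p a b c d
  rw [← a, ← b, ← c, ← d]
  simp only [ENNReal.toNNReal_mul, ENNReal.toReal_mul, smul_eq_mul]
  have key := coneDist_sq_mul hΩ hδ (ωX p.1.1 p.2.1 : ℝ) (ωY p.1.2 p.2.2 : ℝ)
    (((γ₀ : Measure (X × Y)).rnDeriv σ p.1).toNNReal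
      * ((γ₀ : Measure (X × Y)).rnDeriv σ p.2).toNNReal)
    (((γ₁ : Measure (X × Y)).rnDeriv σ p.1).toNNReal
      * ((γ₁ : Measure (X × Y)).rnDeriv σ p.2).toNNReal)
    ((k p.1).toNNReal * (k p.2).toNNReal)
  have comm : ∀ a b c d : ℝ≥0, a * b * (c * d) = b * d * (a * c) := fun a b c d => by ring
  rw [comm, comm ((γ₁ : Measure (X × Y)).rnDeriv σ p.1).toNNReal, key, NNReal.coe_mul]
  rfl

/-! ### The functionals and their variational convergence -/

/-- The augmented loss `Ĥ_δ = H_δ - 4 δ² (μ_X(X) - μ_Y(Y))²` on semi-couplings. -/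
def augmentedLoss {X Y : Type*}
    [TopologicalSpace X] [CompactSpace X] [PolishSpace X] [MeasurableSpace X] [BorelSpace X]
    [TopologicalSpace Y] [CompactSpace Y] [PolishSpace Y] [MeasurableSpace Y] [BorelSpace Y]
    (Ω : ℝ → ℝ) (NX : MeasureNetwork X) (NY : MeasureNetwork Y) (δ : ℝ)
    (γ : SemiCouplings NX.μ NY.μ) : ℝ :=
  cgwLoss Ω δ NX.ω NY.ω γ.1.1 γ.1.2
    - 4 * δ ^ 2 * ((NX.μ.mass : ℝ) - (NY.μ.mass : ℝ)) ^ 2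

open Classical in
/-- The limit functional `H_∞` with constant `C`. -/
def limitLoss {X Y : Type*}
    [TopologicalSpace X] [CompactSpace X] [PolishSpace X] [MeasurableSpace X] [BorelSpace X]
    [TopologicalSpace Y] [CompactSpace Y] [PolishSpace Y] [MeasurableSpace Y] [BorelSpace Y]
    (C : ℝ) (NX : MeasureNetwork X) (NY : MeasureNetwork Y)
    (γ : SemiCouplings NX.μ NY.μ) : EReal :=
  if γ.1.1 = 0 ∨ γ.1.2 = 0 then 0
  else if γ.1.2 = (NY.μ.mass / NX.μ.mass) • γ.1.1 then
    ((2 * C * ((NY.μ.mass : ℝ) / (NX.μ.mass : ℝ)) *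
      ∫ p : (X × Y) × (X × Y), |(NX.ω p.1.1 p.2.1 : ℝ) - (NY.ω p.1.2 p.2.2 : ℝ)| ^ 2
        ∂((γ.1.1 : Measure (X × Y)).prod (γ.1.1 : Measure (X × Y))) : ℝ) : EReal)
  else ⊤

/-- Sequential `Γ`-convergence of extended-real functionals: the lim-inf inequality along every
convergent sequence, and the lim-sup inequality along some convergent sequence. -/
def GammaConverges {U : Type*} [TopologicalSpace U] (E : ℕ → U → EReal) (Einf : U → EReal) : Prop :=
  (∀ (u : U) (v : ℕ → U), Tendsto v atTop (𝓝 u) →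
    Einf u ≤ liminf (fun n => E n (v n)) atTop) ∧
  (∀ u : U, ∃ v : ℕ → U, Tendsto v atTop (𝓝 u) ∧
    limsup (fun n => E n (v n)) atTop ≤ Einf u)

end

/-! Write m₀, m₁ for the masses of γ₀, γ₁, put α = m₁/m₀, and let g = √(f₀f₁) be the overlap of the
densities. The marginal constraints fix m₀ and m₁, so expanding the cone distance and subtracting
4δ²(m₀ - m₁)² leaves 8δ²(m₀m₁ - ∬ Ω(|ω_X - ω_Y|/2δ) g⊗g) (`augmentedLoss_eq`).

Since Ω ≤ 1, this is at least 8δ² times the Cauchy-Schwarz deficit m₀m₁ - (∫g)². Bounded losses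
therefore force the deficit to be O(δ⁻²). The quantitative equality case `integral_sub_mul_sq_le`
then sends the Hellinger distance between γ₁ and αγ₀ to zero, so that a weak limit satisfies γ₁ =
αγ₀. Inserting Ω(z) ≤ 1 - Cz² + C'z⁴ bounds the loss below by 2C ∬ |ω_X - ω_Y|² g⊗g - O(δ⁻²), and
here g may be replaced by √α f₀ in L¹.

It remains to pass to the weak limit in ∬ |ω_X - ω_Y|² dγ₀dγ₀, although the kernels are only
measurable. This works because the marginals are controlled: the first marginal of γ₀ is μ_X, and
the second is asymptotically μ_Y/α in total variation. After expanding the square only the mixed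
term uses weak convergence, and there each kernel is approximated in L¹ by a continuous one
(`tendsto_integral_sq_kernelGap`).

For the upper bound the constant sequence suffices: when γ₁ = αγ₀ the overlap is explicit and Ω(z) ≥
1 - Cz² gives the inequality for every δ. -/

/-- The Cauchy-Schwarz inequality for square integrable functions. -/
theorem integral_mul_le_sqrt_mul_sqrt {α : Type*} [MeasurableSpace α] {μ : Measure α}
    {f g : α → ℝ} (hf : MemLp f 2 μ) (hg : MemLp g 2 μ) :
    ∫ x, |f x * g x| ∂μ ≤ √(∫ x, f x ^ 2 ∂μ) * √(∫ x, g x ^ 2 ∂μ) := by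
  have h := integral_mul_le_Lp_mul_Lq_of_nonneg (μ := μ) (Real.HolderConjugate.two_two)
    (f := fun x => |f x|) (g := fun x => |g x|)
    (Eventually.of_forall fun x => abs_nonneg _) (Eventually.of_forall fun x => abs_nonneg _)
    (by rw [ENNReal.ofReal_ofNat]; exact hf.abs) (by rw [ENNReal.ofReal_ofNat]; exact hg.abs)
  simpa [abs_mul, Real.sqrt_eq_rpow] using h

/-! ### Stability of the Cauchy-Schwarz inequality -/

section Hellinger

variable {α : Type*} [MeasurableSpace α] {μ : Measure α} {a b : α → ℝ}

theorem integral_sub_mul_sq (ha : MemLp a 2 μ) (hb : MemLp b 2 μ) (s : ℝ) :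
    ∫ x, (b x - s * a x) ^ 2 ∂μ
      = (∫ x, b x ^ 2 ∂μ) + s ^ 2 * (∫ x, a x ^ 2 ∂μ) - 2 * s * ∫ x, a x * b x ∂μ := by
  have e : ∀ x, (b x - s * a x) ^ 2 = b x ^ 2 + s ^ 2 * a x ^ 2 - 2 * s * (a x * b x) :=
    fun x => by ring
  have hab : Integrable (fun x => a x * b x) μ := ha.integrable_mul hb
  have h1 := hb.integrable_sq
  have h2 := ha.integrable_sq.const_mul (s ^ 2)
  simp_rw [e]
  have h3 := integral_sub (h1.add h2) (hab.const_mul (2 * s))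
  simp only [Pi.add_apply] at h3
  rw [h3, integral_add h1 h2, integral_const_mul, integral_const_mul]

/-- The `L¹` distance of `b²` and `s² a²` is controlled by the `L²` distance of `b` and `s a`. -/
theorem integral_abs_sq_sub_sq_le (ha : MemLp a 2 μ) (hb : MemLp b 2 μ) (s : ℝ) :
    ∫ x, |b x ^ 2 - s ^ 2 * a x ^ 2| ∂μ
      ≤ √(∫ x, (b x - s * a x) ^ 2 ∂μ)
        * √(2 * ((∫ x, b x ^ 2 ∂μ) + s ^ 2 * ∫ x, a x ^ 2 ∂μ)) := by
  have hsa := ha.const_mul s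
  have e : ∀ x, b x ^ 2 - s ^ 2 * a x ^ 2 = (b x - s * a x) * (b x + s * a x) :=
    fun x => by ring
  simp_rw [e]
  refine (integral_mul_le_sqrt_mul_sqrt (hb.sub hsa) (hb.add hsa)).trans ?_
  refine mul_le_mul_of_nonneg_left (Real.sqrt_le_sqrt ?_) (Real.sqrt_nonneg _)
  -- Parallelogram law: the expansions at s and -s add up to 2(‖b‖² + s²‖a‖²), which therefore
  -- bounds ‖b + sa‖².
  have h1 := integral_sub_mul_sq ha hb s
  have h2 := integral_sub_mul_sq ha hb (-s)
  have h3 : 0 ≤ ∫ x, (b x - s * a x) ^ 2 ∂μ := integral_nonneg fun x => sq_nonneg _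
  simp only [neg_mul, sub_neg_eq_add] at h2
  show ∫ x, (b x + s * a x) ^ 2 ∂μ ≤ _
  linarith [neg_sq s ▸ h2]

/-- The `L¹` distance of `a b` and `s a²` is controlled by the `L²` distance of `b` and `s a`. -/
theorem integral_abs_mul_sub_le (ha : MemLp a 2 μ) (hb : MemLp b 2 μ) (s : ℝ) :
    ∫ x, |a x * b x - s * a x ^ 2| ∂μ
      ≤ √(∫ x, a x ^ 2 ∂μ) * √(∫ x, (b x - s * a x) ^ 2 ∂μ) := by
  have e : ∀ x, a x * b x - s * a x ^ 2 = a x * (b x - s * a x) := fun x => by ring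
  simp_rw [e]
  exact integral_mul_le_sqrt_mul_sqrt ha (hb.sub (ha.const_mul s))

/-- A quantitative form of the equality case of the Cauchy-Schwarz inequality. -/
theorem integral_sub_mul_sq_le (ha : MemLp a 2 μ) (hb : MemLp b 2 μ)
    (ha0 : 0 ≤ a) (hb0 : 0 ≤ b) {m₀ m₁ : ℝ} (hm₀ : 0 < m₀) (hm₁ : 0 < m₁)
    (h₀ : ∫ x, a x ^ 2 ∂μ = m₀) (h₁ : ∫ x, b x ^ 2 ∂μ = m₁) :
    m₀ * ∫ x, (b x - √(m₁ / m₀) * a x) ^ 2 ∂μ ≤ 2 * (m₀ * m₁ - (∫ x, a x * b x ∂μ) ^ 2) := by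
  set s := √(m₁ / m₀)
  have hs : s ^ 2 * m₀ = m₁ := by
    rw [Real.sq_sqrt (by positivity)]; field_simp
  have hs0 : 0 ≤ s := Real.sqrt_nonneg _
  have hG : 0 ≤ ∫ x, a x * b x ∂μ := integral_nonneg fun x => mul_nonneg (ha0 x) (hb0 x)
  have hD : 0 ≤ ∫ x, (b x - s * a x) ^ 2 ∂μ := integral_nonneg fun x => sq_nonneg _
  rw [integral_sub_mul_sq ha hb, h₀, h₁, hs] at hD ⊢
  set G := ∫ x, a x * b x ∂μ
  -- The squared distance is 2(m₁ - sG), so its nonnegativity gives sG ≤ m₁. After multiplication by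
  -- m₁ = s²m₀ the right side is 2m₀(m₁ - sG)(m₁ + sG), and it exceeds the left side by 2m₀(m₁ -
  -- sG)sG ≥ 0.
  have h2 : s * G ≤ m₁ := by linarith
  have h3 : 0 ≤ s * G * (m₁ - s * G) := mul_nonneg (by positivity) (by linarith)
  have h4 : m₁ * (m₀ * (m₁ + m₁ - 2 * s * G)) ≤ m₁ * (2 * (m₀ * m₁ - G ^ 2)) := by
    have : m₁ * G ^ 2 = m₀ * (s * G) ^ 2 := by rw [← hs]; ring
    nlinarith [mul_nonneg hm₀.le h3]
  exact le_of_mul_le_mul_left h4 hm₁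

end Hellinger

/-! ### Quadratic forms of bounded kernels -/

theorem integrable_bounded_mul_prod {α : Type*} [MeasurableSpace α] {μ : Measure α} [SFinite μ]
    {k : α × α → ℝ} (hk : Measurable k) {K : ℝ} (hK : ∀ p, |k p| ≤ K) {u : α → ℝ}
    (hu : Integrable u μ) :
    Integrable (fun p : α × α => k p * (u p.1 * u p.2)) (μ.prod μ) :=
  (hu.mul_prod hu).bdd_mul hk.aestronglyMeasurable (Eventually.of_forall hK)

/-- Stability in `L¹` of the quadratic form of a bounded kernel. -/
theorem abs_integral_kernel_sub_le {α : Type*} [MeasurableSpace α] {μ : Measure α} [SFinite μ]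
    {k : α × α → ℝ} (hk : Measurable k) {K : ℝ} (hK : ∀ p, |k p| ≤ K) {u v : α → ℝ}
    (hu : Integrable u μ) (hv : Integrable v μ) :
    |(∫ p : α × α, k p * (u p.1 * u p.2) ∂(μ.prod μ))
        - ∫ p : α × α, k p * (v p.1 * v p.2) ∂(μ.prod μ)|
      ≤ K * (((∫ x, |u x| ∂μ) + ∫ x, |v x| ∂μ) * ∫ x, |u x - v x| ∂μ) := by
  have huv := (hu.sub hv).abs
  have i₁ := huv.mul_prod hu.abs
  have i₂ := hv.abs.mul_prod huv
  rw [← integral_sub (integrable_bounded_mul_prod hk hK hu)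
    (integrable_bounded_mul_prod hk hK hv)]
  refine (abs_integral_le_integral_abs).trans ?_
  have key : ∫ p : α × α, |k p * (u p.1 * u p.2) - k p * (v p.1 * v p.2)| ∂(μ.prod μ)
      ≤ ∫ p : α × α, K * (|u p.1 - v p.1| * |u p.2| + |v p.1| * |u p.2 - v p.2|) ∂(μ.prod μ) := by
    refine integral_mono_of_nonneg (Eventually.of_forall fun p => abs_nonneg _)
      ((i₁.add i₂).const_mul K) (Eventually.of_forall fun p => ?_)
    show |k p * (u p.1 * u p.2) - k p * (v p.1 * v p.2)| ≤ _
    -- Changing one factor at a time produces tensor products, whose integrals factor.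
    have e : k p * (u p.1 * u p.2) - k p * (v p.1 * v p.2)
        = k p * ((u p.1 - v p.1) * u p.2 + v p.1 * (u p.2 - v p.2)) := by ring
    rw [e, abs_mul]
    refine mul_le_mul (hK p) ?_ (abs_nonneg _) ((abs_nonneg _).trans (hK p))
    exact (abs_add_le _ _).trans_eq (by rw [abs_mul, abs_mul])
  refine key.trans_eq ?_
  rw [integral_const_mul]
  congr 1
  have := integral_add i₁ i₂
  simp only [Pi.sub_apply] at this
  rw [this, integral_prod_mul (fun x => |u x - v x|) (fun x => |u x|),
    integral_prod_mul (fun x => |v x|) (fun x => |u x - v x|)]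
  ring

/-- Integrals against `ν ⊗ ν` in terms of the density of `ν`. -/
theorem integral_prod_eq_integral_rnDeriv {α : Type*} [MeasurableSpace α] {μ ν : Measure α}
    [SigmaFinite μ] [IsFiniteMeasure ν] (h : ν ≪ μ) (k : α × α → ℝ) :
    ∫ p, k p ∂(ν.prod ν)
      = ∫ p : α × α, k p * ((ν.rnDeriv μ p.1).toReal * (ν.rnDeriv μ p.2).toReal)
        ∂(μ.prod μ) := by
  have hm : Measurable (ν.rnDeriv μ) := Measure.measurable_rnDeriv _ _
  have hfin : ∀ᵐ p ∂μ, ν.rnDeriv μ p < ∞ := Measure.rnDeriv_lt_top _ _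
  have hprod : ν.prod ν
      = (μ.prod μ).withDensity fun p : α × α => ν.rnDeriv μ p.1 * ν.rnDeriv μ p.2 := by
    have := prod_withDensity (μ := μ) (ν := μ) hm hm
    rw [← this, Measure.withDensity_rnDeriv_eq _ _ h]
  have hlt : ∀ᵐ p : α × α ∂(μ.prod μ), ν.rnDeriv μ p.1 * ν.rnDeriv μ p.2 < ∞ := by
    filter_upwards [Measure.quasiMeasurePreserving_fst.ae hfin,
      Measure.quasiMeasurePreserving_snd.ae hfin] with p hp hq
    exact ENNReal.mul_lt_top hp hq
  rw [hprod, integral_withDensity_eq_integral_toReal_smul (by fun_prop) hlt]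
  simp only [ENNReal.toReal_mul, smul_eq_mul]
  exact integral_congr_ae (Eventually.of_forall fun p => mul_comm _ _)

/-! ### Weak convergence tested on discontinuous products -/

/-- The product of finite measures is continuous for weak convergence to nonzero limits. -/
theorem tendsto_finiteMeasure_prod {ι α β : Type*} [TopologicalSpace α] [TopologicalSpace β]
    [SecondCountableTopology α] [SecondCountableTopology β]
    [TopologicalSpace.PseudoMetrizableSpace α] [TopologicalSpace.PseudoMetrizableSpace β]
    [MeasurableSpace α] [BorelSpace α] [MeasurableSpace β] [BorelSpace β] {l : Filter ι}
    {μ : ι → FiniteMeasure α} {ν : ι → FiniteMeasure β}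
    {μ' : FiniteMeasure α} {ν' : FiniteMeasure β} (hμ : Tendsto μ l (𝓝 μ'))
    (hν : Tendsto ν l (𝓝 ν')) (hμ0 : μ' ≠ 0) (hν0 : ν' ≠ 0) :
    Tendsto (fun i => (μ i).prod (ν i)) l (𝓝 (μ'.prod ν')) := by
  have : Nonempty α := by
    by_contra h
    rw [not_nonempty_iff] at h
    exact hμ0 (Subtype.ext (Measure.eq_zero_of_isEmpty _))
  have : Nonempty β := by
    by_contra h
    rw [not_nonempty_iff] at h
    exact hν0 (Subtype.ext (Measure.eq_zero_of_isEmpty _))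
  -- Splitting off the masses reduces the claim to continuity of the product of probability
  -- measures. Normalization is continuous only at nonzero measures, whence the hypotheses on the
  -- limits.
  have e : ∀ (a : FiniteMeasure α) (b : FiniteMeasure β), a.prod b
      = (a.mass * b.mass) • (a.normalize.prod b.normalize).toFiniteMeasure := by
    intro a b
    apply Subtype.ext
    conv_lhs => rw [a.self_eq_mass_smul_normalize, b.self_eq_mass_smul_normalize]
    simp [Measure.prod_smul_left, Measure.prod_smul_right, smul_smul]
    rw [mul_comm]
  simp_rw [e]
  refine (hμ.mass.mul hν.mass).smul ?_
  have h := (ProbabilityMeasure.continuous_prod (α := α) (β := β)).tendsto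
    (μ'.normalize, ν'.normalize)
  have h' := h.comp ((FiniteMeasure.tendsto_normalize_of_tendsto hμ hμ0).prodMk_nhds
    (FiniteMeasure.tendsto_normalize_of_tendsto hν hν0))
  exact (ProbabilityMeasure.toFiniteMeasure_continuous.tendsto _).comp h'

/-- Convergence of integrals passes to functions that can be approximated in `L¹`, uniformly in the
sense of a convergent majorant of the error. -/
theorem tendsto_integral_of_approx {ι α : Type*} [MeasurableSpace α] {l : Filter ι}
    {N : ι → Measure α} {N' : Measure α} {h : α → ℝ} (hN : ∀ i, Integrable h (N i))
    (hN' : Integrable h N')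
    (H : ∀ ε > 0, ∃ g r : α → ℝ, (∀ x, |h x - g x| ≤ r x) ∧ (∀ i, Integrable g (N i)) ∧
      Integrable g N' ∧ (∀ i, Integrable r (N i)) ∧ Integrable r N' ∧
      Tendsto (fun i => ∫ x, g x ∂(N i)) l (𝓝 (∫ x, g x ∂N')) ∧
      Tendsto (fun i => ∫ x, r x ∂(N i)) l (𝓝 (∫ x, r x ∂N')) ∧ ∫ x, r x ∂N' ≤ ε) :
    Tendsto (fun i => ∫ x, h x ∂(N i)) l (𝓝 (∫ x, h x ∂N')) := by
  have aux : ∀ {μ : Measure α} {g r : α → ℝ}, Integrable h μ → Integrable g μ →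
      Integrable r μ → (∀ x, |h x - g x| ≤ r x) →
      |(∫ x, h x ∂μ) - ∫ x, g x ∂μ| ≤ ∫ x, r x ∂μ := by
    intro μ g r hh hg hr hle
    rw [← integral_sub hh hg]
    exact abs_integral_le_integral_abs.trans (integral_mono (hh.sub hg).abs hr hle)
  rw [Metric.tendsto_nhds]
  intro ε hε
  -- The error budget is ε/2 for h - g along the family, ε/4 for the convergence of g, and ε/4 for h
  -- - g at the limit.
  obtain ⟨g, r, hle, gi, gN, ri, rN, tg, tr, hr⟩ := H (ε / 4) (by positivity)
  have h1 := (Metric.tendsto_nhds.1 tg) (ε / 4) (by positivity)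
  have h2 := tr.eventually (gt_mem_nhds (show ∫ x, r x ∂N' < ε / 2 by linarith))
  filter_upwards [h1, h2] with i h1 h2
  rw [Real.dist_eq] at h1 ⊢
  have a1 := abs_le.1 (aux (hN i) (gi i) (ri i) hle)
  have a2 := abs_le.1 (aux hN' gN rN hle)
  have a3 := abs_lt.1 h1
  rw [abs_lt]
  constructor <;> linarith

section MarginalConvergence

theorem integrable_of_abs_le {α : Type*} [MeasurableSpace α] {μ : Measure α} [IsFiniteMeasure μ]
    {k : α → ℝ} (hk : Measurable k) {K : ℝ} (hK : ∀ p, |k p| ≤ K) : Integrable k μ :=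
  Integrable.of_bound hk.aestronglyMeasurable K (Eventually.of_forall hK)

variable {ι X Y : Type*}
    [TopologicalSpace X] [MeasurableSpace X] [BorelSpace X]
    [TopologicalSpace Y] [PolishSpace Y] [MeasurableSpace Y] [BorelSpace Y]
    {l : Filter ι}

/-- If a sequence of measures on `X × Y` converges weakly, and integrals of bounded measurable
functions of the second variable converge, then so do the integrals of products of a bounded
continuous function of the first variable by a bounded measurable function of the second one. -/
theorem tendsto_integral_continuous_mul_measurable
    {N : ι → FiniteMeasure (X × Y)} {N' : FiniteMeasure (X × Y)} (hN : Tendsto N l (𝓝 N'))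
    (hY : ∀ (k : Y → ℝ) (K : ℝ), Measurable k → (∀ y, |k y| ≤ K) →
      Tendsto (fun i => ∫ p : X × Y, k p.2 ∂(N i : Measure (X × Y))) l
        (𝓝 (∫ p : X × Y, k p.2 ∂(N' : Measure (X × Y)))))
    (φ : BoundedContinuousFunction X ℝ) {k : Y → ℝ} (hk : Measurable k) {K : ℝ}
    (hK : ∀ y, |k y| ≤ K) :
    Tendsto (fun i => ∫ p : X × Y, φ p.1 * k p.2 ∂(N i : Measure (X × Y))) l
      (𝓝 (∫ p : X × Y, φ p.1 * k p.2 ∂(N' : Measure (X × Y)))) := by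
  have hφ : ∀ x, |φ x| ≤ ‖φ‖ := fun x => φ.norm_coe_le_norm x
  have hmφ : Measurable φ := φ.continuous.measurable
  have bm : ∀ {k : Y → ℝ} {K : ℝ}, (∀ y, |k y| ≤ K) → ∀ p : X × Y, |φ p.1 * k p.2| ≤ ‖φ‖ * K := by
    intro k K hK p
    rw [abs_mul]
    exact mul_le_mul (hφ _) (hK _) (abs_nonneg _) (norm_nonneg _)
  have mm : ∀ {k : Y → ℝ}, Measurable k → Measurable fun p : X × Y => φ p.1 * k p.2 :=
    fun hk => (hmφ.comp measurable_fst).mul (hk.comp measurable_snd)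
  refine tendsto_integral_of_approx
    (fun i => integrable_of_abs_le (mm hk) (bm hK)) (integrable_of_abs_le (mm hk) (bm hK))
    fun ε hε => ?_
  have hpos : 0 < ‖φ‖ + 1 := by positivity
  -- Approximation is needed only in L¹ of the limit marginal: the error depends on y alone, so `hY`
  -- carries its smallness back to the family. The constant ‖φ‖ + 1 avoids division by zero.
  obtain ⟨ψ, hψ, -⟩ := (integrable_of_abs_le (μ := (N' : Measure (X × Y)).map Prod.snd)
    hk hK).exists_boundedContinuous_integral_sub_le (ε := ε / (‖φ‖ + 1)) (by positivity)
  have hψb : ∀ y, |ψ y| ≤ ‖ψ‖ := fun x => ψ.norm_coe_le_norm x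
  have hmψ : Measurable ψ := ψ.continuous.measurable
  set d : Y → ℝ := fun y => (‖φ‖ + 1) * |k y - ψ y| with hd
  have hdm : Measurable d := by fun_prop
  have hdb : ∀ y, |d y| ≤ (‖φ‖ + 1) * (K + ‖ψ‖) := by
    intro y
    rw [hd, abs_mul, abs_abs, abs_of_pos hpos]
    exact mul_le_mul_of_nonneg_left
      ((abs_sub _ _).trans (add_le_add (hK y) (hψb y))) hpos.le
  refine ⟨fun p => φ p.1 * ψ p.2, fun p => d p.2, fun p => ?_,
    fun i => integrable_of_abs_le (mm hmψ) (bm hψb), integrable_of_abs_le (mm hmψ) (bm hψb),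
    fun i => integrable_of_abs_le (hdm.comp measurable_snd) (fun p => hdb p.2),
    integrable_of_abs_le (hdm.comp measurable_snd) (fun p => hdb p.2), ?_, hY d _ hdm hdb, ?_⟩
  · rw [← mul_sub, abs_mul]
    exact mul_le_mul_of_nonneg_right ((hφ _).trans (by linarith)) (abs_nonneg _)
  · exact FiniteMeasure.tendsto_iff_forall_integral_tendsto.1 hN
      (φ.compContinuous ⟨Prod.fst, continuous_fst⟩ * ψ.compContinuous ⟨Prod.snd, continuous_snd⟩)
  · rw [integral_map measurable_snd.aemeasurable
      (by exact ((hk.sub hmψ).norm).aestronglyMeasurable)] at hψ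
    rw [hd]
    simp only [integral_const_mul]
    rw [le_div_iff₀ hpos, mul_comm] at hψ
    exact hψ

/-- If a sequence of measures on `X × Y` converges weakly, and the integrals of bounded measurable
functions of one variable converge, then so do the integrals of products of bounded measurable
functions of one variable. -/
theorem tendsto_integral_measurable_mul_measurable [PolishSpace X]
    {N : ι → FiniteMeasure (X × Y)} {N' : FiniteMeasure (X × Y)} (hN : Tendsto N l (𝓝 N'))
    (hX : ∀ (k : X → ℝ) (K : ℝ), Measurable k → (∀ x, |k x| ≤ K) →
      Tendsto (fun i => ∫ p : X × Y, k p.1 ∂(N i : Measure (X × Y))) l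
        (𝓝 (∫ p : X × Y, k p.1 ∂(N' : Measure (X × Y)))))
    (hY : ∀ (k : Y → ℝ) (K : ℝ), Measurable k → (∀ y, |k y| ≤ K) →
      Tendsto (fun i => ∫ p : X × Y, k p.2 ∂(N i : Measure (X × Y))) l
        (𝓝 (∫ p : X × Y, k p.2 ∂(N' : Measure (X × Y)))))
    {j : X → ℝ} (hj : Measurable j) {J : ℝ} (hJ : ∀ x, |j x| ≤ J)
    {k : Y → ℝ} (hk : Measurable k) {K : ℝ} (hK : ∀ y, |k y| ≤ K) :
    Tendsto (fun i => ∫ p : X × Y, j p.1 * k p.2 ∂(N i : Measure (X × Y))) l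
      (𝓝 (∫ p : X × Y, j p.1 * k p.2 ∂(N' : Measure (X × Y)))) := by
  have bm : ∀ {j : X → ℝ} {J : ℝ}, (∀ x, |j x| ≤ J) → ∀ p : X × Y, |j p.1 * k p.2| ≤ J * K := by
    intro j J hJ p
    rw [abs_mul]
    exact mul_le_mul (hJ _) (hK _) (abs_nonneg _) ((abs_nonneg _).trans (hJ p.1))
  have mm : ∀ {j : X → ℝ}, Measurable j → Measurable fun p : X × Y => j p.1 * k p.2 :=
    fun hj => (hj.comp measurable_fst).mul (hk.comp measurable_snd)
  refine tendsto_integral_of_approx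
    (fun i => integrable_of_abs_le (mm hj) (bm hJ)) (integrable_of_abs_le (mm hj) (bm hJ))
    fun ε hε => ?_
  have hpos : 0 < |K| + 1 := by positivity
  -- The same approximation in the other variable; the approximant ψ(x)k(y) is covered by the
  -- previous lemma.
  obtain ⟨ψ, hψ, -⟩ := (integrable_of_abs_le (μ := (N' : Measure (X × Y)).map Prod.fst)
    hj hJ).exists_boundedContinuous_integral_sub_le (ε := ε / (|K| + 1)) (by positivity)
  have hψb : ∀ y, |ψ y| ≤ ‖ψ‖ := fun x => ψ.norm_coe_le_norm x
  have hmψ : Measurable ψ := ψ.continuous.measurable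
  set d : X → ℝ := fun x => (|K| + 1) * |j x - ψ x| with hd
  have hdm : Measurable d := by fun_prop
  have hdb : ∀ x, |d x| ≤ (|K| + 1) * (J + ‖ψ‖) := by
    intro x
    rw [hd, abs_mul, abs_abs, abs_of_pos hpos]
    exact mul_le_mul_of_nonneg_left
      ((abs_sub _ _).trans (add_le_add (hJ x) (hψb x))) hpos.le
  refine ⟨fun p => ψ p.1 * k p.2, fun p => d p.1, fun p => ?_,
    fun i => integrable_of_abs_le (mm hmψ) (bm hψb), integrable_of_abs_le (mm hmψ) (bm hψb),
    fun i => integrable_of_abs_le (hdm.comp measurable_fst) (fun p => hdb p.1),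
    integrable_of_abs_le (hdm.comp measurable_fst) (fun p => hdb p.1),
    tendsto_integral_continuous_mul_measurable hN hY ψ hk hK, hX d _ hdm hdb, ?_⟩
  · rw [← sub_mul, abs_mul, mul_comm]
    exact mul_le_mul_of_nonneg_right ((hK _).trans (by linarith [le_abs_self K])) (abs_nonneg _)
  · rw [integral_map measurable_fst.aemeasurable
      (by exact ((hj.sub hmψ).norm).aestronglyMeasurable)] at hψ
    rw [hd]
    simp only [integral_const_mul]
    rw [le_div_iff₀ hpos, mul_comm] at hψ
    exact hψ

end MarginalConvergence

section SquareConvergence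

variable {ι X Y : Type*}
    [TopologicalSpace X] [PolishSpace X] [MeasurableSpace X] [BorelSpace X]
    [TopologicalSpace Y] [PolishSpace Y] [MeasurableSpace Y] [BorelSpace Y]
    {l : Filter ι}

/-- Convergence of the quadratic functionals of `γ` given by a product of bounded measurable kernels
on `X` and on `Y`, when `γ` converges weakly and the functionals given by a single kernel
converge. -/
theorem tendsto_integral_prod_kernel_mul_kernel
    {γ : ι → FiniteMeasure (X × Y)} {γ' : FiniteMeasure (X × Y)} (hγ : Tendsto γ l (𝓝 γ'))
    (h0 : γ' ≠ 0)
    (hX : ∀ (k : X × X → ℝ) (K : ℝ), Measurable k → (∀ x, |k x| ≤ K) →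
      Tendsto (fun i => ∫ p : (X × Y) × (X × Y), k (p.1.1, p.2.1)
        ∂((γ i : Measure (X × Y)).prod (γ i))) l
        (𝓝 (∫ p : (X × Y) × (X × Y), k (p.1.1, p.2.1) ∂((γ' : Measure (X × Y)).prod γ'))))
    (hY : ∀ (k : Y × Y → ℝ) (K : ℝ), Measurable k → (∀ x, |k x| ≤ K) →
      Tendsto (fun i => ∫ p : (X × Y) × (X × Y), k (p.1.2, p.2.2)
        ∂((γ i : Measure (X × Y)).prod (γ i))) l
        (𝓝 (∫ p : (X × Y) × (X × Y), k (p.1.2, p.2.2) ∂((γ' : Measure (X × Y)).prod γ'))))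
    {j : X × X → ℝ} (hj : Measurable j) {J : ℝ} (hJ : ∀ x, |j x| ≤ J)
    {k : Y × Y → ℝ} (hk : Measurable k) {K : ℝ} (hK : ∀ y, |k y| ≤ K) :
    Tendsto (fun i => ∫ p : (X × Y) × (X × Y), j (p.1.1, p.2.1) * k (p.1.2, p.2.2)
        ∂((γ i : Measure (X × Y)).prod (γ i))) l
      (𝓝 (∫ p : (X × Y) × (X × Y), j (p.1.1, p.2.1) * k (p.1.2, p.2.2)
        ∂((γ' : Measure (X × Y)).prod γ'))) := by
  -- Regrouping coordinates turns γ ⊗ γ into a measure on X² × Y², so that a kernel on X or on Y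
  -- becomes a function of one variable.
  let T : (X × Y) × (X × Y) → (X × X) × (Y × Y) := fun p => ((p.1.1, p.2.1), (p.1.2, p.2.2))
  have hT : Continuous T := by fun_prop
  have hmap : ∀ (ν : FiniteMeasure (X × Y)) {f : (X × X) × (Y × Y) → ℝ}, Measurable f →
      ∫ q, f q ∂(((ν.prod ν).map T : FiniteMeasure _) : Measure ((X × X) × (Y × Y)))
        = ∫ p, f (T p) ∂((ν : Measure (X × Y)).prod ν) := by
    intro ν f hf
    exact integral_map hT.measurable.aemeasurable hf.aestronglyMeasurable
  have hN := FiniteMeasure.tendsto_map_of_tendsto_of_continuous _ _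
    (tendsto_finiteMeasure_prod hγ hγ h0 h0) hT
  have := tendsto_integral_measurable_mul_measurable hN
    (fun k K hk hK => by
      simp_rw [hmap _ (f := fun q => k q.1) (hk.comp measurable_fst)]
      exact hX k K hk hK)
    (fun k K hk hK => by
      simp_rw [hmap _ (f := fun q => k q.2) (hk.comp measurable_snd)]
      exact hY k K hk hK) hj hJ hk hK
  simp_rw [hmap _ (f := fun q => j q.1 * k q.2)
    ((hj.comp measurable_fst).mul (hk.comp measurable_snd))] at this
  exact this

end SquareConvergence

/-! ### Square roots of densities -/

/-- The square root of the density of `ν` with respect to `μ`. -/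
noncomputable def sqrtDensity {α : Type*} [MeasurableSpace α] (ν μ : Measure α) (z : α) : ℝ :=
  √((ν.rnDeriv μ z).toReal)

section SqrtDensity

variable {α : Type*} [MeasurableSpace α] {ν μ : Measure α}

theorem sqrtDensity_nonneg : 0 ≤ sqrtDensity ν μ := fun _ => Real.sqrt_nonneg _

theorem sq_sqrtDensity (z : α) : sqrtDensity ν μ z ^ 2 = (ν.rnDeriv μ z).toReal :=
  Real.sq_sqrt ENNReal.toReal_nonneg

theorem measurable_sqrtDensity : Measurable (sqrtDensity ν μ) :=
  (Measure.measurable_rnDeriv ν μ).ennreal_toReal.sqrt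

theorem memLp_sqrtDensity [IsFiniteMeasure ν] : MemLp (sqrtDensity ν μ) 2 μ := by
  rw [memLp_two_iff_integrable_sq measurable_sqrtDensity.aestronglyMeasurable]
  simp_rw [sq_sqrtDensity]
  exact Measure.integrable_toReal_rnDeriv

theorem integral_sq_sqrtDensity [SigmaFinite μ] [IsFiniteMeasure ν] (h : ν ≪ μ) :
    ∫ z, sqrtDensity ν μ z ^ 2 ∂μ = ν.real Set.univ := by
  simp_rw [sq_sqrtDensity]
  exact Measure.integral_toReal_rnDeriv h

theorem FiniteMeasure.real_univ_eq_mass (ν : FiniteMeasure α) :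
    (ν : Measure α).real Set.univ = ν.mass := rfl

end SqrtDensity

/-! ### Measurability of the cone kernel -/

/-- Submultiplicativity gives Ω(w) ≤ Ω(z)Ω(w - z), and the last factor is at most 1. Monotonicity is
the source of measurability, which is not among the axioms. -/
theorem IsConeFunction.antitoneOn {Ω : ℝ → ℝ} (hΩ : IsConeFunction Ω) :
    AntitoneOn Ω (Set.Ici 0) := by
  intro z hz w _ hzw
  have h := hΩ.map_add_le z (w - z) hz (by linarith)
  rw [add_sub_cancel] at h
  have h1 := hΩ.mem_unit z hz
  have h2 := hΩ.mem_unit (w - z) (by linarith)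
  nlinarith

theorem IsConeFunction.measurable_comp {Ω : ℝ → ℝ} (hΩ : IsConeFunction Ω) {α : Type*}
    [MeasurableSpace α] {f : α → ℝ} (hf : Measurable f) (hf0 : ∀ x, 0 ≤ f x) :
    Measurable fun x => Ω (f x) := by
  -- Ω is unconstrained on negative numbers, so it is first made constant there.
  have h : Antitone fun z => Ω (max z 0) := fun z w hzw =>
    hΩ.antitoneOn (Set.mem_Ici.2 (le_max_right _ _)) (Set.mem_Ici.2 (le_max_right _ _)) (max_le_max_right 0 hzw)
  have e : (fun x => Ω (f x)) = (fun z => Ω (max z 0)) ∘ f := by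
    ext x
    simp [max_eq_left (hf0 x)]
  rw [e]
  exact h.measurable.comp hf

/-- The difference of two kernels, as a function on `(X × Y)²`. -/
def kernelGap {X Y : Type*} (ωX : X → X → ℝ≥0) (ωY : Y → Y → ℝ≥0) (p : (X × Y) × (X × Y)) : ℝ :=
  |(ωX p.1.1 p.2.1 : ℝ) - (ωY p.1.2 p.2.2 : ℝ)|

theorem kernelGap_nonneg {X Y : Type*} (ωX : X → X → ℝ≥0) (ωY : Y → Y → ℝ≥0) (p : (X × Y) × (X × Y)) :
    0 ≤ kernelGap ωX ωY p := abs_nonneg _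

theorem IsConeFunction.abs_kernel_le {X Y : Type*} {Ω : ℝ → ℝ} (hΩ : IsConeFunction Ω) {δ : ℝ} (hδ : 0 < δ)
    (ωX : X → X → ℝ≥0) (ωY : Y → Y → ℝ≥0) (p : (X × Y) × (X × Y)) :
    |Ω (kernelGap ωX ωY p / (2 * δ))| ≤ 1 := by
  have h := hΩ.mem_unit _ (div_nonneg (kernelGap_nonneg ωX ωY p) (by positivity : 0 ≤ 2 * δ))
  rw [abs_of_nonneg h.1]
  exact h.2

/-! ### The loss in terms of the overlap of densities -/

section Loss

variable {X Y : Type*} [MeasurableSpace X] [MeasurableSpace Y]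

theorem measurable_kernelGap {ωX : X → X → ℝ≥0} {ωY : Y → Y → ℝ≥0}
    (hωX : Measurable fun p : X × X => ωX p.1 p.2) (hωY : Measurable fun p : Y × Y => ωY p.1 p.2) :
    Measurable (kernelGap ωX ωY) := by
  have h1 : Measurable fun p : (X × Y) × (X × Y) => (ωX p.1.1 p.2.1 : ℝ) :=
    (hωX.comp ((measurable_fst.comp measurable_fst).prodMk
      (measurable_fst.comp measurable_snd))).coe_nnreal_real
  have h2 : Measurable fun p : (X × Y) × (X × Y) => (ωY p.1.2 p.2.2 : ℝ) :=
    (hωY.comp ((measurable_snd.comp measurable_fst).prodMk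
      (measurable_snd.comp measurable_snd))).coe_nnreal_real
  exact (h1.sub h2).abs

theorem IsConeFunction.measurable_kernel {Ω : ℝ → ℝ} (hΩ : IsConeFunction Ω) {δ : ℝ} (hδ : 0 < δ)
    {ωX : X → X → ℝ≥0} {ωY : Y → Y → ℝ≥0}
    (hωX : Measurable fun p : X × X => ωX p.1 p.2) (hωY : Measurable fun p : Y × Y => ωY p.1 p.2) :
    Measurable fun p => Ω (kernelGap ωX ωY p / (2 * δ)) :=
  hΩ.measurable_comp ((measurable_kernelGap hωX hωY).div_const _) fun p =>
    div_nonneg (kernelGap_nonneg _ _ p) (by positivity)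

/-- The square root of the product of the densities of two measures. -/
noncomputable def overlap (γ₀ γ₁ μ : Measure (X × Y)) (z : X × Y) : ℝ :=
  sqrtDensity γ₀ μ z * sqrtDensity γ₁ μ z

theorem integrable_overlap (γ₀ γ₁ μ : Measure (X × Y)) [IsFiniteMeasure γ₀] [IsFiniteMeasure γ₁] :
    Integrable (overlap γ₀ γ₁ μ) μ :=
  memLp_sqrtDensity.integrable_mul memLp_sqrtDensity

theorem overlap_nonneg (γ₀ γ₁ μ : Measure (X × Y)) (z : X × Y) : 0 ≤ overlap γ₀ γ₁ μ z :=
  mul_nonneg (sqrtDensity_nonneg z) (sqrtDensity_nonneg z)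

/-- The loss, with the square expanded. -/
theorem cgwLossWith_eq {Ω : ℝ → ℝ} (hΩ : IsConeFunction Ω) {δ : ℝ} (hδ : 0 < δ)
    {ωX : X → X → ℝ≥0} {ωY : Y → Y → ℝ≥0}
    (hωX : Measurable fun p : X × X => ωX p.1 p.2) (hωY : Measurable fun p : Y × Y => ωY p.1 p.2)
    (γ₀ γ₁ : FiniteMeasure (X × Y)) (μ : Measure (X × Y)) [SigmaFinite μ]
    (h₀ : (γ₀ : Measure (X × Y)) ≪ μ) (h₁ : (γ₁ : Measure (X × Y)) ≪ μ) :
    cgwLossWith Ω δ ωX ωY γ₀ γ₁ μ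
      = 4 * δ ^ 2 * ((γ₀.mass : ℝ) ^ 2 + (γ₁.mass : ℝ) ^ 2
        - 2 * ∫ p : (X × Y) × (X × Y), Ω (kernelGap ωX ωY p / (2 * δ))
          * (overlap γ₀ γ₁ μ p.1 * overlap γ₀ γ₁ μ p.2) ∂(μ.prod μ)) := by
  have i₀ : Integrable (fun z => sqrtDensity (γ₀ : Measure (X × Y)) μ z ^ 2) μ :=
    memLp_sqrtDensity.integrable_sq
  have i₁ : Integrable (fun z => sqrtDensity (γ₁ : Measure (X × Y)) μ z ^ 2) μ :=
    memLp_sqrtDensity.integrable_sq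
  have e₀ := integral_sq_sqrtDensity h₀
  have e₁ := integral_sq_sqrtDensity h₁
  rw [FiniteMeasure.real_univ_eq_mass] at e₀ e₁
  have ig := integrable_bounded_mul_prod (hΩ.measurable_kernel hδ hωX hωY)
    (hΩ.abs_kernel_le hδ ωX ωY) (integrable_overlap (γ₀ : Measure (X × Y)) γ₁ μ)
  have hs := integral_sub ((i₀.mul_prod i₀).add (i₁.mul_prod i₁)) (ig.const_mul 2)
  have ha := integral_add (i₀.mul_prod i₀) (i₁.mul_prod i₁)
  simp only [Pi.add_apply] at hs
  rw [ha, integral_prod_mul (fun z => sqrtDensity (γ₀ : Measure (X × Y)) μ z ^ 2)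
    (fun z => sqrtDensity (γ₀ : Measure (X × Y)) μ z ^ 2),
    integral_prod_mul (fun z => sqrtDensity (γ₁ : Measure (X × Y)) μ z ^ 2)
    (fun z => sqrtDensity (γ₁ : Measure (X × Y)) μ z ^ 2), e₀, e₁, integral_const_mul] at hs
  rw [sq (γ₀.mass : ℝ), sq (γ₁.mass : ℝ), ← hs, ← integral_const_mul]
  unfold cgwLossWith
  refine integral_congr_ae (Eventually.of_forall fun p => ?_)
  have hp : ∀ x y : ℝ≥0∞, ((NNReal.sqrt (x.toNNReal * y.toNNReal) : ℝ≥0) : ℝ)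
      = √x.toReal * √y.toReal := by
    intro x y
    rw [NNReal.sqrt_mul, NNReal.coe_mul, Real.coe_sqrt, Real.coe_sqrt]
    rfl
  simp only [coneDist_sq hΩ hδ, hp, Real.dist_eq]
  simp only [overlap, kernelGap, sqrtDensity]
  ring

end Loss

/-! ### Consequences of a small Hellinger distance -/

section HellingerGap

variable {α : Type*} [MeasurableSpace α]

/-- The squared Hellinger distance between `γ₁` and the multiple of `γ₀` of the same mass. -/
noncomputable def hellingerGap (γ₀ γ₁ : FiniteMeasure α) : ℝ :=
  ∫ z, (sqrtDensity (γ₁ : Measure α) (γ₀ + γ₁ : Measure α) z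
    - √((γ₁.mass : ℝ) / γ₀.mass) * sqrtDensity (γ₀ : Measure α) (γ₀ + γ₁ : Measure α) z) ^ 2
    ∂(γ₀ + γ₁ : Measure α)

theorem absolutelyContinuous_add_left (μ ν : Measure α) : μ ≪ μ + ν :=
  Measure.absolutelyContinuous_of_le (Measure.le_add_right le_rfl)

theorem absolutelyContinuous_add_right (μ ν : Measure α) : ν ≪ μ + ν :=
  Measure.absolutelyContinuous_of_le (Measure.le_add_left le_rfl)

theorem integral_sq_sqrtDensity_mass {μ : Measure α} [SigmaFinite μ] {ν : FiniteMeasure α}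
    (h : (ν : Measure α) ≪ μ) : ∫ z, sqrtDensity (ν : Measure α) μ z ^ 2 ∂μ = ν.mass :=
  integral_sq_sqrtDensity h

variable {γ₀ γ₁ : FiniteMeasure α}

theorem hellingerGap_nonneg : 0 ≤ hellingerGap γ₀ γ₁ := integral_nonneg fun _ => sq_nonneg _

/-- The right side is twice the Cauchy-Schwarz deficit, the quantity that a bounded loss makes
small. -/
theorem mass_mul_hellingerGap_le (h₀ : 0 < γ₀.mass) (h₁ : 0 < γ₁.mass) :
    γ₀.mass * hellingerGap γ₀ γ₁
      ≤ 2 * (γ₀.mass * γ₁.mass - (∫ z, sqrtDensity (γ₀ : Measure α) (γ₀ + γ₁ : Measure α) z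
        * sqrtDensity (γ₁ : Measure α) (γ₀ + γ₁ : Measure α) z ∂(γ₀ + γ₁ : Measure α)) ^ 2) :=
  integral_sub_mul_sq_le memLp_sqrtDensity memLp_sqrtDensity sqrtDensity_nonneg sqrtDensity_nonneg
    (NNReal.coe_pos.2 h₀) (NNReal.coe_pos.2 h₁)
    (integral_sq_sqrtDensity_mass (absolutelyContinuous_add_left _ _))
    (integral_sq_sqrtDensity_mass (absolutelyContinuous_add_right _ _))

theorem sq_sqrt_mass_div_mul (h₀ : 0 < γ₀.mass) :
    √((γ₁.mass : ℝ) / γ₀.mass) ^ 2 * γ₀.mass = γ₁.mass := by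
  have : (0 : ℝ) < γ₀.mass := NNReal.coe_pos.2 h₀
  rw [Real.sq_sqrt (by positivity)]
  field_simp

/-- Hellinger control implies total variation control. Both densities have integral m₁, so the
factor 2(m₁ + m₁) becomes 4m₁. -/
theorem integral_abs_density_sub_le (h₀ : 0 < γ₀.mass) :
    ∫ z, |sqrtDensity (γ₁ : Measure α) (γ₀ + γ₁ : Measure α) z ^ 2
        - √((γ₁.mass : ℝ) / γ₀.mass) ^ 2
          * sqrtDensity (γ₀ : Measure α) (γ₀ + γ₁ : Measure α) z ^ 2| ∂(γ₀ + γ₁ : Measure α)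
      ≤ √(hellingerGap γ₀ γ₁) * √(4 * γ₁.mass) := by
  have h := integral_abs_sq_sub_sq_le (μ := (γ₀ + γ₁ : Measure α))
    (memLp_sqrtDensity (ν := (γ₀ : Measure α))) (memLp_sqrtDensity (ν := (γ₁ : Measure α)))
    √((γ₁.mass : ℝ) / γ₀.mass)
  rw [integral_sq_sqrtDensity_mass (absolutelyContinuous_add_left _ _),
    integral_sq_sqrtDensity_mass (absolutelyContinuous_add_right _ _),
    sq_sqrt_mass_div_mul h₀] at h
  refine h.trans_eq ?_
  rw [show 2 * ((γ₁.mass : ℝ) + γ₁.mass) = 4 * γ₁.mass by ring]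
  rfl

/-- Integrals of bounded functions against `γ₁` and a multiple of `γ₀`. -/
theorem abs_integral_sub_le_hellingerGap (h₀ : 0 < γ₀.mass) {f : α → ℝ} (hf : Measurable f)
    {K : ℝ} (hK0 : 0 ≤ K) (hK : ∀ z, |f z| ≤ K) :
    |(∫ z, f z ∂(γ₁ : Measure α)) - (γ₁.mass : ℝ) / γ₀.mass * ∫ z, f z ∂(γ₀ : Measure α)|
      ≤ K * (√(hellingerGap γ₀ γ₁) * √(4 * γ₁.mass)) := by
  set σ : Measure α := (γ₀ + γ₁ : Measure α) with hσ
  have i₀ : Integrable (fun z => sqrtDensity (γ₀ : Measure α) σ z ^ 2) σ :=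
    memLp_sqrtDensity.integrable_sq
  have i₁ : Integrable (fun z => sqrtDensity (γ₁ : Measure α) σ z ^ 2) σ :=
    memLp_sqrtDensity.integrable_sq
  have e : ∀ ν : FiniteMeasure α, (ν : Measure α) ≪ σ →
      ∫ z, f z ∂(ν : Measure α) = ∫ z, f z * sqrtDensity (ν : Measure α) σ z ^ 2 ∂σ := by
    intro ν hν
    simp_rw [sq_sqrtDensity]
    rw [← integral_toReal_rnDeriv_mul hν]
    simp_rw [mul_comm]
  have i₀' := (i₀.bdd_mul hf.aestronglyMeasurable (Eventually.of_forall hK)).const_mul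
    ((γ₁.mass : ℝ) / γ₀.mass)
  have i₁' := i₁.bdd_mul hf.aestronglyMeasurable (Eventually.of_forall hK)
  rw [e γ₀ (absolutelyContinuous_add_left _ _), e γ₁ (absolutelyContinuous_add_right _ _),
    ← integral_const_mul, ← integral_sub i₁' i₀']
  refine abs_integral_le_integral_abs.trans (le_trans ?_
    (mul_le_mul_of_nonneg_left (integral_abs_density_sub_le h₀) hK0))
  rw [← integral_const_mul]
  refine integral_mono (i₁'.sub i₀').abs ((i₁.sub (i₀.const_mul _)).abs.const_mul K) fun z => ?_
  show |_| ≤ K * |_|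
  rw [Real.sq_sqrt (by positivity)]
  have : f z * sqrtDensity (γ₁ : Measure α) σ z ^ 2
      - (γ₁.mass : ℝ) / γ₀.mass * (f z * sqrtDensity (γ₀ : Measure α) σ z ^ 2)
      = f z * (sqrtDensity (γ₁ : Measure α) σ z ^ 2
        - (γ₁.mass : ℝ) / γ₀.mass * sqrtDensity (γ₀ : Measure α) σ z ^ 2) := by ring
  rw [this, abs_mul]
  exact mul_le_mul_of_nonneg_right (hK z) (abs_nonneg _)

/-- Integrals of bounded kernels against `γ₁ ⊗ γ₁` and a multiple of `γ₀ ⊗ γ₀`. -/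
theorem abs_integral_prod_sub_le_hellingerGap (h₀ : 0 < γ₀.mass) {k : α × α → ℝ}
    (hk : Measurable k) {K : ℝ} (hK0 : 0 ≤ K) (hK : ∀ z, |k z| ≤ K) :
    |(∫ p, k p ∂((γ₁ : Measure α).prod γ₁))
        - ((γ₁.mass : ℝ) / γ₀.mass) ^ 2 * ∫ p, k p ∂((γ₀ : Measure α).prod γ₀)|
      ≤ K * (((γ₁.mass : ℝ) + γ₁.mass) * (√(hellingerGap γ₀ γ₁) * √(4 * γ₁.mass))) := by
  set σ : Measure α := (γ₀ + γ₁ : Measure α) with hσ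
  set s : ℝ := √((γ₁.mass : ℝ) / γ₀.mass) with hs
  have hs2 : (γ₁.mass : ℝ) / γ₀.mass = s ^ 2 := (Real.sq_sqrt (by positivity)).symm
  have ac₀ : (γ₀ : Measure α) ≪ σ := absolutelyContinuous_add_left _ _
  have ac₁ : (γ₁ : Measure α) ≪ σ := absolutelyContinuous_add_right _ _
  have i₀ : Integrable (fun z => s ^ 2 * sqrtDensity (γ₀ : Measure α) σ z ^ 2) σ :=
    memLp_sqrtDensity.integrable_sq.const_mul _
  have i₁ : Integrable (fun z => sqrtDensity (γ₁ : Measure α) σ z ^ 2) σ :=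
    memLp_sqrtDensity.integrable_sq
  have h := abs_integral_kernel_sub_le hk hK i₁ i₀
  have n₀ : ∫ z, |s ^ 2 * sqrtDensity (γ₀ : Measure α) σ z ^ 2| ∂σ = γ₁.mass := by
    have : ∀ z, |s ^ 2 * sqrtDensity (γ₀ : Measure α) σ z ^ 2|
      = s ^ 2 * sqrtDensity (γ₀ : Measure α) σ z ^ 2 := fun z => abs_of_nonneg (by positivity)
    simp_rw [this]
    rw [integral_const_mul, integral_sq_sqrtDensity_mass ac₀, sq_sqrt_mass_div_mul h₀]
  have n₁ : ∫ z, |sqrtDensity (γ₁ : Measure α) σ z ^ 2| ∂σ = γ₁.mass := by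
    simp_rw [abs_sq]
    exact integral_sq_sqrtDensity_mass ac₁
  rw [n₀, n₁] at h
  have e₀ : ((γ₁.mass : ℝ) / γ₀.mass) ^ 2 * ∫ p, k p ∂((γ₀ : Measure α).prod γ₀)
      = ∫ p : α × α, k p * ((s ^ 2 * sqrtDensity (γ₀ : Measure α) σ p.1 ^ 2)
        * (s ^ 2 * sqrtDensity (γ₀ : Measure α) σ p.2 ^ 2)) ∂(σ.prod σ) := by
    rw [integral_prod_eq_integral_rnDeriv ac₀, ← integral_const_mul, hs2]
    simp_rw [sq_sqrtDensity]
    congr 1 with p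
    ring
  have e₁ : ∫ p, k p ∂((γ₁ : Measure α).prod γ₁)
      = ∫ p : α × α, k p * (sqrtDensity (γ₁ : Measure α) σ p.1 ^ 2
        * sqrtDensity (γ₁ : Measure α) σ p.2 ^ 2) ∂(σ.prod σ) := by
    rw [integral_prod_eq_integral_rnDeriv ac₁]
    simp_rw [sq_sqrtDensity]
  rw [e₀, e₁]
  refine h.trans (mul_le_mul_of_nonneg_left (mul_le_mul_of_nonneg_left ?_ (by positivity)) hK0)
  exact integral_abs_density_sub_le h₀

end HellingerGap

/-! ### Kernels integrated against the overlap -/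

section OverlapKernel

variable {X Y : Type*} [MeasurableSpace X] [MeasurableSpace Y] {γ₀ γ₁ : FiniteMeasure (X × Y)}

theorem integral_overlap_le {μ : Measure (X × Y)} [SigmaFinite μ]
    (h₀ : (γ₀ : Measure (X × Y)) ≪ μ) (h₁ : (γ₁ : Measure (X × Y)) ≪ μ) :
    ∫ z, overlap γ₀ γ₁ μ z ∂μ ≤ √γ₀.mass * √γ₁.mass := by
  have h := integral_mul_le_sqrt_mul_sqrt (μ := μ)
    (memLp_sqrtDensity (ν := (γ₀ : Measure (X × Y))))
    (memLp_sqrtDensity (ν := (γ₁ : Measure (X × Y))))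
  rw [integral_sq_sqrtDensity_mass h₀, integral_sq_sqrtDensity_mass h₁] at h
  refine le_trans (le_of_eq ?_) h
  exact integral_congr_ae (Eventually.of_forall fun z => (abs_of_nonneg (overlap_nonneg _ _ _ z)).symm)

theorem sq_integral_overlap_le {μ : Measure (X × Y)} [SigmaFinite μ]
    (h₀ : (γ₀ : Measure (X × Y)) ≪ μ) (h₁ : (γ₁ : Measure (X × Y)) ≪ μ) :
    (∫ z, overlap γ₀ γ₁ μ z ∂μ) ^ 2 ≤ γ₀.mass * γ₁.mass := by
  have h := pow_le_pow_left₀ (integral_nonneg (overlap_nonneg _ _ _))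
    (integral_overlap_le h₀ h₁) 2
  rwa [mul_pow, Real.sq_sqrt (by positivity), Real.sq_sqrt (by positivity)] at h

/-- Quadratic functionals of the overlap and of a multiple of `γ₀`. -/
theorem abs_integral_overlap_sub_le_hellingerGap {k : (X × Y) × (X × Y) → ℝ}
    (hk : Measurable k) {K : ℝ} (hK0 : 0 ≤ K) (hK : ∀ z, |k z| ≤ K) :
    |(∫ p : (X × Y) × (X × Y), k p * (overlap γ₀ γ₁ (γ₀ + γ₁ : Measure (X × Y)) p.1
          * overlap γ₀ γ₁ (γ₀ + γ₁ : Measure (X × Y)) p.2)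
          ∂((γ₀ + γ₁ : Measure (X × Y)).prod (γ₀ + γ₁ : Measure (X × Y))))
        - (γ₁.mass : ℝ) / γ₀.mass * ∫ p, k p ∂((γ₀ : Measure (X × Y)).prod γ₀)|
      ≤ K * ((√γ₀.mass * √γ₁.mass + √((γ₁.mass : ℝ) / γ₀.mass) * γ₀.mass)
        * (√γ₀.mass * √(hellingerGap γ₀ γ₁))) := by
  set σ : Measure (X × Y) := (γ₀ + γ₁ : Measure (X × Y)) with hσ
  set s : ℝ := √((γ₁.mass : ℝ) / γ₀.mass) with hs
  have hs2 : (γ₁.mass : ℝ) / γ₀.mass = s ^ 2 := (Real.sq_sqrt (by positivity)).symm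
  have ac₀ : (γ₀ : Measure (X × Y)) ≪ σ := absolutelyContinuous_add_left _ _
  have ac₁ : (γ₁ : Measure (X × Y)) ≪ σ := absolutelyContinuous_add_right _ _
  have i₀ : Integrable (fun z => s * sqrtDensity (γ₀ : Measure (X × Y)) σ z ^ 2) σ :=
    memLp_sqrtDensity.integrable_sq.const_mul _
  have h := abs_integral_kernel_sub_le hk hK (integrable_overlap (γ₀ : Measure (X × Y)) γ₁ σ) i₀
  have n₀ : ∫ z, |s * sqrtDensity (γ₀ : Measure (X × Y)) σ z ^ 2| ∂σ = s * γ₀.mass := by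
    have : ∀ z, |s * sqrtDensity (γ₀ : Measure (X × Y)) σ z ^ 2|
      = s * sqrtDensity (γ₀ : Measure (X × Y)) σ z ^ 2 := fun z => abs_of_nonneg (by positivity)
    simp_rw [this]
    rw [integral_const_mul, integral_sq_sqrtDensity_mass ac₀]
  have n₁ : ∫ z, |overlap (γ₀ : Measure (X × Y)) γ₁ σ z| ∂σ ≤ √γ₀.mass * √γ₁.mass := by
    simp_rw [abs_of_nonneg (overlap_nonneg _ _ _ _)]
    exact integral_overlap_le ac₀ ac₁
  have e₀ : (γ₁.mass : ℝ) / γ₀.mass * ∫ p, k p ∂((γ₀ : Measure (X × Y)).prod γ₀)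
      = ∫ p : (X × Y) × (X × Y), k p * ((s * sqrtDensity (γ₀ : Measure (X × Y)) σ p.1 ^ 2)
        * (s * sqrtDensity (γ₀ : Measure (X × Y)) σ p.2 ^ 2)) ∂(σ.prod σ) := by
    rw [integral_prod_eq_integral_rnDeriv ac₀, ← integral_const_mul, hs2]
    simp_rw [sq_sqrtDensity]
    congr 1 with p
    ring
  rw [e₀]
  refine h.trans (mul_le_mul_of_nonneg_left (mul_le_mul ?_ ?_
    (integral_nonneg fun _ => abs_nonneg _) (by positivity)) hK0)
  · rw [n₀]
    linarith
  · have h' := integral_abs_mul_sub_le (μ := σ) (memLp_sqrtDensity (ν := (γ₀ : Measure (X × Y))))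
      (memLp_sqrtDensity (ν := (γ₁ : Measure (X × Y)))) s
    rw [integral_sq_sqrtDensity_mass ac₀] at h'
    exact h'

theorem integral_mul_overlap_const (c : ℝ) (γ₀ γ₁ μ : Measure (X × Y)) [SFinite μ] :
    ∫ p : (X × Y) × (X × Y), c * (overlap γ₀ γ₁ μ p.1 * overlap γ₀ γ₁ μ p.2) ∂(μ.prod μ)
      = c * (∫ z, overlap γ₀ γ₁ μ z ∂μ) ^ 2 := by
  rw [integral_const_mul, integral_prod_mul, sq]

theorem integral_kernel_overlap_mono {k k' : (X × Y) × (X × Y) → ℝ} (hk : Measurable k)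
    (hk' : Measurable k') {K K' : ℝ} (hK : ∀ p, |k p| ≤ K) (hK' : ∀ p, |k' p| ≤ K')
    (h : ∀ p, k p ≤ k' p) (γ₀ γ₁ μ : Measure (X × Y)) [SFinite μ] [IsFiniteMeasure γ₀]
    [IsFiniteMeasure γ₁] :
    ∫ p : (X × Y) × (X × Y), k p * (overlap γ₀ γ₁ μ p.1 * overlap γ₀ γ₁ μ p.2) ∂(μ.prod μ)
      ≤ ∫ p : (X × Y) × (X × Y), k' p * (overlap γ₀ γ₁ μ p.1 * overlap γ₀ γ₁ μ p.2) ∂(μ.prod μ) :=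
  integral_mono (integrable_bounded_mul_prod hk hK (integrable_overlap _ _ _))
    (integrable_bounded_mul_prod hk' hK' (integrable_overlap _ _ _)) fun p =>
    mul_le_mul_of_nonneg_right (h p) (mul_nonneg (overlap_nonneg _ _ _ _) (overlap_nonneg _ _ _ _))

end OverlapKernel

theorem abs_sq_kernelGap_le {X Y : Type*} {M : ℝ} {ωX : X → X → ℝ≥0} {ωY : Y → Y → ℝ≥0}
    (hM : ∀ (x x' : X) (y y' : Y), |(ωX x x' : ℝ) - (ωY y y' : ℝ)| ≤ M)
    (p : (X × Y) × (X × Y)) : |kernelGap ωX ωY p ^ 2| ≤ M ^ 2 := by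
  rw [abs_sq]
  exact pow_le_pow_left₀ (kernelGap_nonneg _ _ _) (hM _ _ _ _) 2

theorem finiteMeasure_mass_map {α β : Type*} [MeasurableSpace α] [MeasurableSpace β] {f : α → β}
    {ν : FiniteMeasure α} (hf : AEMeasurable f (ν : Measure α)) : (ν.map f).mass = ν.mass := by
  unfold FiniteMeasure.mass
  rw [FiniteMeasure.map_apply_of_aemeasurable _ hf MeasurableSet.univ, Set.preimage_univ]

/-! ### Bounds for the augmented loss at fixed δ -/

section AugmentedLoss

variable {X Y : Type*}
    [TopologicalSpace X] [CompactSpace X] [PolishSpace X] [MeasurableSpace X] [BorelSpace X]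
    [TopologicalSpace Y] [CompactSpace Y] [PolishSpace Y] [MeasurableSpace Y] [BorelSpace Y]
    {NX : MeasureNetwork X} {NY : MeasureNetwork Y}

theorem SemiCouplings.mass_fst (γ : SemiCouplings NX.μ NY.μ) : γ.1.1.mass = NX.μ.mass := by
  have h := congrArg FiniteMeasure.mass γ.2.1
  rwa [finiteMeasure_mass_map measurable_fst.aemeasurable] at h

theorem SemiCouplings.mass_snd (γ : SemiCouplings NX.μ NY.μ) : γ.1.2.mass = NY.μ.mass := by
  have h := congrArg FiniteMeasure.mass γ.2.2
  rwa [finiteMeasure_mass_map measurable_snd.aemeasurable] at h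

variable {Ω : ℝ → ℝ} {δ : ℝ}

/-- The masses are those of the networks, and m₀² + m₁² - (m₀ - m₁)² = 2m₀m₁; this cancellation is
the purpose of the augmentation. -/
theorem augmentedLoss_eq (hΩ : IsConeFunction Ω) (hδ : 0 < δ) (γ : SemiCouplings NX.μ NY.μ)
    (μ : Measure (X × Y)) [SigmaFinite μ]
    (h₀ : (γ.1.1 : Measure (X × Y)) ≪ μ) (h₁ : (γ.1.2 : Measure (X × Y)) ≪ μ) :
    augmentedLoss Ω NX NY δ γ = 8 * δ ^ 2 * (γ.1.1.mass * γ.1.2.mass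
      - ∫ p : (X × Y) × (X × Y), Ω (kernelGap NX.ω NY.ω p / (2 * δ))
          * (overlap γ.1.1 γ.1.2 μ p.1 * overlap γ.1.1 γ.1.2 μ p.2) ∂(μ.prod μ)) := by
  unfold augmentedLoss
  rw [← cgwLossWith_eq_cgwLoss hΩ hδ _ _ _ _ μ h₀ h₁,
    cgwLossWith_eq hΩ hδ NX.measurable_ω NY.measurable_ω _ _ _ h₀ h₁, SemiCouplings.mass_fst,
    SemiCouplings.mass_snd]
  ring

/-- Only Ω ≤ 1 is used. The factor δ² penalizes the Cauchy-Schwarz deficit and enforces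
proportionality in the limit. -/
theorem le_augmentedLoss (hΩ : IsConeFunction Ω) (hδ : 0 < δ) (γ : SemiCouplings NX.μ NY.μ)
    (μ : Measure (X × Y)) [SigmaFinite μ]
    (h₀ : (γ.1.1 : Measure (X × Y)) ≪ μ) (h₁ : (γ.1.2 : Measure (X × Y)) ≪ μ) :
    8 * δ ^ 2 * (γ.1.1.mass * γ.1.2.mass - (∫ z, overlap γ.1.1 γ.1.2 μ z ∂μ) ^ 2)
      ≤ augmentedLoss Ω NX NY δ γ := by
  rw [augmentedLoss_eq hΩ hδ γ μ h₀ h₁]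
  have h := integral_kernel_overlap_mono (hΩ.measurable_kernel hδ NX.measurable_ω NY.measurable_ω)
    (measurable_const (a := (1 : ℝ))) (hΩ.abs_kernel_le hδ NX.ω NY.ω) (K' := 1)
    (fun _ => by simp) (fun p => (le_abs_self _).trans (hΩ.abs_kernel_le hδ NX.ω NY.ω p))
    (γ.1.1 : Measure (X × Y)) γ.1.2 μ
  rw [integral_mul_overlap_const, one_mul] at h
  gcongr

theorem augmentedLoss_nonneg (hΩ : IsConeFunction Ω) (hδ : 0 < δ) (γ : SemiCouplings NX.μ NY.μ) :
    0 ≤ augmentedLoss Ω NX NY δ γ := by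
  have a₀ := absolutelyContinuous_add_left (γ.1.1 : Measure (X × Y)) γ.1.2
  have a₁ := absolutelyContinuous_add_right (γ.1.1 : Measure (X × Y)) γ.1.2
  refine le_trans (mul_nonneg (by positivity) ?_) (le_augmentedLoss hΩ hδ γ _ a₀ a₁)
  linarith [sq_integral_overlap_le a₀ a₁]

/-- At z = gap/(2δ) the prefactor 8δ² turns Cz² into 2C gap², and C'z⁴ into at most C'M⁴/(2δ²). The
condition a₁ ≤ 2δ keeps z in the interval where the expansion holds. -/
theorem le_augmentedLoss_of_upper_bound (hΩ : IsConeFunction Ω) (hδ : 0 < δ) {C C' M a₁ : ℝ}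
    (hC' : 0 ≤ C') (ha₁ : 0 < a₁)
    (hM : ∀ (x x' : X) (y y' : Y), |(NX.ω x x' : ℝ) - (NY.ω y y' : ℝ)| ≤ M)
    (hupper : ∀ z ∈ Set.Icc (0 : ℝ) (M / a₁), Ω z ≤ 1 - C * z ^ 2 + C' * z ^ 4)
    (hδa : a₁ ≤ 2 * δ) (γ : SemiCouplings NX.μ NY.μ) (μ : Measure (X × Y)) [SigmaFinite μ]
    (h₀ : (γ.1.1 : Measure (X × Y)) ≪ μ) (h₁ : (γ.1.2 : Measure (X × Y)) ≪ μ) :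
    2 * C * (∫ p : (X × Y) × (X × Y), kernelGap NX.ω NY.ω p ^ 2
          * (overlap γ.1.1 γ.1.2 μ p.1 * overlap γ.1.1 γ.1.2 μ p.2) ∂(μ.prod μ))
        - C' * M ^ 4 / (2 * δ ^ 2) * (γ.1.1.mass * γ.1.2.mass)
      ≤ augmentedLoss Ω NX NY δ γ := by
  rw [augmentedLoss_eq hΩ hδ γ μ h₀ h₁]
  have hgm := (measurable_kernelGap NX.measurable_ω NY.measurable_ω).pow_const 2
  -- The quartic remainder, bounded uniformly by gap ≤ M, is merged with the constant 1, so that it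
  -- multiplies (∫g)² ≤ m₀m₁.
  set B : ℝ := 1 + C' * M ^ 4 / (16 * δ ^ 4) with hB
  have hpt : ∀ p : (X × Y) × (X × Y), Ω (kernelGap NX.ω NY.ω p / (2 * δ))
      ≤ B - C / (4 * δ ^ 2) * kernelGap NX.ω NY.ω p ^ 2 := by
    intro p
    have g0 := kernelGap_nonneg NX.ω NY.ω p
    have gM : kernelGap NX.ω NY.ω p ≤ M := hM _ _ _ _
    have hz := hupper (kernelGap NX.ω NY.ω p / (2 * δ))
      ⟨by positivity, div_le_div₀ (g0.trans gM) gM ha₁ hδa⟩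
    have h4 : C' * (kernelGap NX.ω NY.ω p / (2 * δ)) ^ 4 ≤ C' * M ^ 4 / (16 * δ ^ 4) := by
      rw [mul_div_assoc]
      refine mul_le_mul_of_nonneg_left ?_ hC'
      rw [div_pow, mul_pow]
      norm_num
      gcongr
    have h2 : C * (kernelGap NX.ω NY.ω p / (2 * δ)) ^ 2
        = C / (4 * δ ^ 2) * kernelGap NX.ω NY.ω p ^ 2 := by
      field_simp
      ring
    linarith
  have hk : ∀ p : (X × Y) × (X × Y), |C / (4 * δ ^ 2) * kernelGap NX.ω NY.ω p ^ 2|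
      ≤ |C / (4 * δ ^ 2)| * M ^ 2 := by
    intro p
    rw [abs_mul]
    exact mul_le_mul_of_nonneg_left (abs_sq_kernelGap_le hM p) (abs_nonneg _)
  have h := integral_kernel_overlap_mono (hΩ.measurable_kernel hδ NX.measurable_ω NY.measurable_ω)
    ((hgm.const_mul (C / (4 * δ ^ 2))).const_sub B) (hΩ.abs_kernel_le hδ NX.ω NY.ω)
    (fun p => (abs_sub _ _).trans (add_le_add le_rfl (hk p))) hpt
    (γ.1.1 : Measure (X × Y)) γ.1.2 μ
  have ig := integrable_overlap (γ.1.1 : Measure (X × Y)) γ.1.2 μ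
  have hs := integral_sub ((ig.mul_prod ig).const_mul B) ((integrable_bounded_mul_prod hgm
    (abs_sq_kernelGap_le hM) ig).const_mul (C / (4 * δ ^ 2)))
  rw [integral_mul_overlap_const, integral_const_mul] at hs
  simp_rw [sub_mul, mul_assoc] at h hs
  rw [hs] at h
  set J := ∫ p : (X × Y) × (X × Y), kernelGap NX.ω NY.ω p ^ 2
          * (overlap γ.1.1 γ.1.2 μ p.1 * overlap γ.1.1 γ.1.2 μ p.2) ∂(μ.prod μ)
  have hG := sq_integral_overlap_le h₀ h₁
  have hB0 : 0 ≤ B := by positivity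
  have h' := mul_le_mul_of_nonneg_left (h.trans (sub_le_sub_right
    (mul_le_mul_of_nonneg_left hG hB0) _)) (by positivity : 0 ≤ 8 * δ ^ 2)
  have e : 8 * δ ^ 2 * (B * (γ.1.1.mass * γ.1.2.mass) - C / (4 * δ ^ 2) * J)
      = 8 * δ ^ 2 * (γ.1.1.mass * γ.1.2.mass)
        + C' * M ^ 4 / (2 * δ ^ 2) * (γ.1.1.mass * γ.1.2.mass) - 2 * C * J := by
    rw [hB]
    field_simp
    ring
  rw [e] at h'
  linarith

/-- With γ₀ as reference measure the densities are 1 and a, so the overlap is the constant √a and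
the loss equals 8δ²a(m₀² - ∬ Ω dγ₀dγ₀). The quadratic lower bound on Ω then leaves no remainder in
δ. -/
theorem augmentedLoss_le_of_lower_bound (hΩ : IsConeFunction Ω) (hδ : 0 < δ) {C M : ℝ}
    (hM : ∀ (x x' : X) (y y' : Y), |(NX.ω x x' : ℝ) - (NY.ω y y' : ℝ)| ≤ M)
    (hlower : ∀ z : ℝ, 0 ≤ z → 1 - C * z ^ 2 ≤ Ω z)
    (γ : SemiCouplings NX.μ NY.μ) {a : ℝ≥0} (ha : a * γ.1.1.mass = γ.1.2.mass)
    (h : γ.1.2 = a • γ.1.1) :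
    augmentedLoss Ω NX NY δ γ ≤ 2 * C * a * ∫ p, kernelGap NX.ω NY.ω p ^ 2
      ∂((γ.1.1 : Measure (X × Y)).prod γ.1.1) := by
  set μ : Measure (X × Y) := ((γ.1.1 : FiniteMeasure (X × Y)) : Measure (X × Y)) with hμ
  have hγ : (γ.1.2 : Measure (X × Y)) = a • μ := by rw [h]; rfl
  have ac : (γ.1.2 : Measure (X × Y)) ≪ μ := by
    rw [hγ]; exact Measure.smul_absolutelyContinuous
  rw [augmentedLoss_eq hΩ hδ γ μ Measure.AbsolutelyContinuous.rfl ac]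
  have hov : ∀ᵐ z ∂μ, overlap γ.1.1 γ.1.2 μ z = √a := by
    have h1 : μ.rnDeriv μ =ᵐ[μ] fun _ => 1 := Measure.rnDeriv_self μ
    have h2 := Measure.rnDeriv_smul_left_of_ne_top μ μ (r := (a : ℝ≥0∞)) ENNReal.coe_ne_top
    filter_upwards [h1, h2] with z h1 h2
    have h2' : ((γ.1.2 : Measure (X × Y)).rnDeriv μ z) = (a : ℝ≥0∞) := by
      rw [hγ]
      refine Eq.trans h2 ?_
      simp [h1]
    simp only [overlap, sqrtDensity, ← hμ, h1, h2']
    simp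
  have e : ∫ p : (X × Y) × (X × Y), Ω (kernelGap NX.ω NY.ω p / (2 * δ))
      * (overlap μ γ.1.2 μ p.1 * overlap μ γ.1.2 μ p.2) ∂(μ.prod μ)
      = a * ∫ p, Ω (kernelGap NX.ω NY.ω p / (2 * δ)) ∂(μ.prod μ) := by
    rw [← integral_const_mul]
    refine integral_congr_ae ?_
    filter_upwards [Measure.quasiMeasurePreserving_fst.ae hov,
      Measure.quasiMeasurePreserving_snd.ae hov] with p h1 h2
    rw [h1, h2, Real.mul_self_sqrt (by positivity), mul_comm]
  rw [e]
  have hgm := (measurable_kernelGap NX.measurable_ω NY.measurable_ω).pow_const 2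
  have i1 : Integrable (fun p => kernelGap NX.ω NY.ω p ^ 2) (μ.prod μ) :=
    integrable_of_abs_le hgm (abs_sq_kernelGap_le hM)
  have hI : (μ.prod μ).real Set.univ - C / (4 * δ ^ 2) * ∫ p, kernelGap NX.ω NY.ω p ^ 2 ∂(μ.prod μ)
      ≤ ∫ p, Ω (kernelGap NX.ω NY.ω p / (2 * δ)) ∂(μ.prod μ) := by
    have : ∫ p, (1 - C / (4 * δ ^ 2) * kernelGap NX.ω NY.ω p ^ 2) ∂(μ.prod μ)
        ≤ ∫ p, Ω (kernelGap NX.ω NY.ω p / (2 * δ)) ∂(μ.prod μ) := by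
      refine integral_mono ((integrable_const _).sub (i1.const_mul _))
        (integrable_of_abs_le (hΩ.measurable_kernel hδ NX.measurable_ω NY.measurable_ω)
          (hΩ.abs_kernel_le hδ NX.ω NY.ω)) fun p => ?_
      have hz := hlower (kernelGap NX.ω NY.ω p / (2 * δ))
        (div_nonneg (kernelGap_nonneg _ _ _) (by positivity))
      have h2 : C * (kernelGap NX.ω NY.ω p / (2 * δ)) ^ 2
          = C / (4 * δ ^ 2) * kernelGap NX.ω NY.ω p ^ 2 := by
        field_simp
        ring
      show 1 - C / (4 * δ ^ 2) * kernelGap NX.ω NY.ω p ^ 2 ≤ _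
      linarith
    rw [integral_sub (integrable_const _) (i1.const_mul _), integral_const_mul] at this
    simpa using this
  have hmass : (μ.prod μ).real Set.univ = (γ.1.1.mass : ℝ) * γ.1.1.mass := by
    rw [← Set.univ_prod_univ, measureReal_prod_prod]
    rfl
  have ha' : (a : ℝ) * γ.1.1.mass = γ.1.2.mass := by exact_mod_cast ha
  rw [hmass] at hI
  rw [← ha']
  set I := ∫ p, kernelGap NX.ω NY.ω p ^ 2 ∂(μ.prod μ)
  have h3 := mul_le_mul_of_nonneg_left hI (by positivity : (0 : ℝ) ≤ 8 * δ ^ 2 * a)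
  have e3 : 8 * δ ^ 2 * a * (γ.1.1.mass * γ.1.1.mass - C / (4 * δ ^ 2) * I)
      = 8 * δ ^ 2 * a * (γ.1.1.mass * γ.1.1.mass) - 2 * C * a * I := by
    field_simp
    ring
  rw [e3] at h3
  linarith

end AugmentedLoss

/-! ### Limits along families with bounded loss -/

section VariationalConvergence

variable {ι X Y : Type*}
    [TopologicalSpace X] [CompactSpace X] [PolishSpace X] [MeasurableSpace X] [BorelSpace X]
    [TopologicalSpace Y] [CompactSpace Y] [PolishSpace Y] [MeasurableSpace Y] [BorelSpace Y]
    {NX : MeasureNetwork X} {NY : MeasureNetwork Y} {l : Filter ι}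
    {v : ι → SemiCouplings NX.μ NY.μ} {u : SemiCouplings NX.μ NY.μ}

/-- If the augmented losses are bounded as `δ → ∞`, the second component of the semi-coupling gets
close to a multiple of the first one. -/
theorem tendsto_hellingerGap_of_augmentedLoss_le {Ω : ℝ → ℝ} (hΩ : IsConeFunction Ω) {δ : ι → ℝ}
    (hδ : ∀ i, 0 < δ i) (hδl : Tendsto δ l atTop) {c : ℝ}
    (hc : ∀ᶠ i in l, augmentedLoss Ω NX NY (δ i) (v i) ≤ c) (h₀ : 0 < NX.μ.mass)
    (h₁ : 0 < NY.μ.mass) :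
    Tendsto (fun i => hellingerGap (v i).1.1 (v i).1.2) l (𝓝 0) := by
  have hm : (0 : ℝ) < NX.μ.mass := NNReal.coe_pos.2 h₀
  -- Combine 8δ² · deficit ≤ c with m₀ · gap ≤ 2 · deficit.
  have hlim : Tendsto (fun i => c / (4 * NX.μ.mass * δ i ^ 2)) l (𝓝 0) :=
    Tendsto.div_atTop tendsto_const_nhds
      (((tendsto_pow_atTop two_ne_zero).comp hδl).const_mul_atTop (by positivity))
  refine tendsto_of_tendsto_of_tendsto_of_le_of_le' tendsto_const_nhds hlim
    (Eventually.of_forall fun i => hellingerGap_nonneg) ?_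
  filter_upwards [hc] with i hi
  have hd := hδ i
  have a₀ := absolutelyContinuous_add_left ((v i).1.1 : Measure (X × Y)) (v i).1.2
  have a₁ := absolutelyContinuous_add_right ((v i).1.1 : Measure (X × Y)) (v i).1.2
  have h1 := (le_augmentedLoss hΩ hd (v i) _ a₀ a₁).trans hi
  have h2 := mass_mul_hellingerGap_le (γ₀ := (v i).1.1) (γ₁ := (v i).1.2)
    (by rwa [SemiCouplings.mass_fst]) (by rwa [SemiCouplings.mass_snd])
  have h3 : (v i).1.1.mass * hellingerGap (v i).1.1 (v i).1.2
      ≤ 2 * ((v i).1.1.mass * (v i).1.2.mass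
        - (∫ z, overlap (v i).1.1 (v i).1.2 ((v i).1.1 + (v i).1.2 : Measure (X × Y)) z
          ∂((v i).1.1 + (v i).1.2 : Measure (X × Y))) ^ 2) := h2
  rw [SemiCouplings.mass_fst] at h1 h3
  rw [le_div_iff₀ (by positivity)]
  have := mul_le_mul_of_nonneg_left h3 (by positivity : 0 ≤ 4 * δ i ^ 2)
  linarith

theorem tendsto_fst (hv : Tendsto v l (𝓝 u)) : Tendsto (fun i => (v i).1.1) l (𝓝 u.1.1) :=
  ((continuous_fst.comp continuous_subtype_val).tendsto u).comp hv

theorem tendsto_snd (hv : Tendsto v l (𝓝 u)) : Tendsto (fun i => (v i).1.2) l (𝓝 u.1.2) :=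
  ((continuous_snd.comp continuous_subtype_val).tendsto u).comp hv

theorem tendsto_zero_of_abs_le {f g : ι → ℝ} (h : ∀ i, |f i| ≤ g i) (hg : Tendsto g l (𝓝 0)) :
    Tendsto f l (𝓝 0) :=
  squeeze_zero_norm h hg

theorem tendsto_sqrt_zero {f : ι → ℝ} (hf : Tendsto f l (𝓝 0)) :
    Tendsto (fun i => √(f i)) l (𝓝 0) := by
  have h := (Real.continuous_sqrt.tendsto 0).comp hf
  rwa [Real.sqrt_zero] at h

/-- In the limit, the second component of the semi-coupling is a multiple of the first one. -/
theorem snd_eq_smul_fst_of_tendsto_hellingerGap [NeBot l] (hv : Tendsto v l (𝓝 u))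
    (hH : Tendsto (fun i => hellingerGap (v i).1.1 (v i).1.2) l (𝓝 0)) (h₀ : 0 < NX.μ.mass) :
    u.1.2 = (NY.μ.mass / NX.μ.mass) • u.1.1 := by
  have key : ∀ f : BoundedContinuousFunction (X × Y) ℝ,
      ∫ z, f z ∂(u.1.2 : Measure (X × Y))
        = (NY.μ.mass : ℝ) / NX.μ.mass * ∫ z, f z ∂(u.1.1 : Measure (X × Y)) := by
    intro f
    have t₀ := FiniteMeasure.tendsto_iff_forall_integral_tendsto.1 (tendsto_fst hv) f
    have t₁ := FiniteMeasure.tendsto_iff_forall_integral_tendsto.1 (tendsto_snd hv) f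
    have t := t₁.sub (t₀.const_mul ((NY.μ.mass : ℝ) / NX.μ.mass))
    have b : Tendsto (fun i => ‖f‖ * (√(hellingerGap (v i).1.1 (v i).1.2) * √(4 * NY.μ.mass))) l
        (𝓝 0) := by
      simpa using ((tendsto_sqrt_zero hH).mul_const (√(4 * NY.μ.mass))).const_mul ‖f‖
    have hb : ∀ i, |(∫ z, f z ∂((v i).1.2 : Measure (X × Y)))
        - (NY.μ.mass : ℝ) / NX.μ.mass * ∫ z, f z ∂((v i).1.1 : Measure (X × Y))|
        ≤ ‖f‖ * (√(hellingerGap (v i).1.1 (v i).1.2) * √(4 * NY.μ.mass)) := fun i => by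
      have := abs_integral_sub_le_hellingerGap (γ₀ := (v i).1.1) (γ₁ := (v i).1.2)
        (by rwa [SemiCouplings.mass_fst]) f.continuous.measurable (norm_nonneg f)
        (fun z => f.norm_coe_le_norm z)
      rw [SemiCouplings.mass_fst, SemiCouplings.mass_snd] at this
      exact this
    have t' := tendsto_zero_of_abs_le hb b
    exact sub_eq_zero.1 (tendsto_nhds_unique t t')
  have h : (u.1.2 : Measure (X × Y)) = ((NY.μ.mass / NX.μ.mass) • u.1.1 : FiniteMeasure (X × Y)) := by
    refine ext_of_forall_integral_eq_of_IsFiniteMeasure fun f => ?_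
    refine (key f).trans ?_
    rw [FiniteMeasure.toMeasure_smul, integral_smul_nnreal_measure]
    rfl
  exact Subtype.ext h

/-- Functionals given by a kernel on the first factor only depend on the first marginal. -/
theorem integral_prod_kernel_fst (γ : SemiCouplings NX.μ NY.μ) {k : X × X → ℝ}
    (hk : Measurable k) :
    ∫ p : (X × Y) × (X × Y), k (p.1.1, p.2.1) ∂((γ.1.1 : Measure (X × Y)).prod γ.1.1)
      = ∫ q, k q ∂((NX.μ : Measure X).prod NX.μ) := by
  have h : (γ.1.1 : Measure (X × Y)).map Prod.fst = NX.μ :=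
    congrArg (fun m : FiniteMeasure X => (m : Measure X)) γ.2.1
  rw [← h, Measure.map_prod_map _ _ measurable_fst measurable_fst,
    integral_map (by fun_prop) hk.aestronglyMeasurable]
  rfl

/-- Functionals given by a kernel on the second factor only depend on the second marginal. -/
theorem integral_prod_kernel_snd (γ : SemiCouplings NX.μ NY.μ) {k : Y × Y → ℝ}
    (hk : Measurable k) :
    ∫ p : (X × Y) × (X × Y), k (p.1.2, p.2.2) ∂((γ.1.2 : Measure (X × Y)).prod γ.1.2)
      = ∫ q, k q ∂((NY.μ : Measure Y).prod NY.μ) := by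
  have h : (γ.1.2 : Measure (X × Y)).map Prod.snd = NY.μ :=
    congrArg (fun m : FiniteMeasure Y => (m : Measure Y)) γ.2.2
  rw [← h, Measure.map_prod_map _ _ measurable_snd measurable_snd,
    integral_map (by fun_prop) hk.aestronglyMeasurable]
  rfl

theorem integral_prod_smul_smul {α : Type*} [MeasurableSpace α] (a : ℝ≥0) (μ : Measure α)
    [SFinite μ] (k : α × α → ℝ) :
    ∫ p, k p ∂((a • μ).prod (a • μ)) = (a : ℝ) ^ 2 * ∫ p, k p ∂(μ.prod μ) := by
  rw [Measure.prod_smul_left, Measure.prod_smul_right, integral_smul_nnreal_measure,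
    integral_smul_nnreal_measure, sq, mul_assoc]
  rfl

/-- The functionals given by a kernel on the second factor converge. -/
theorem tendsto_integral_prod_kernel_snd
    (hH : Tendsto (fun i => hellingerGap (v i).1.1 (v i).1.2) l (𝓝 0)) (h₀ : 0 < NX.μ.mass)
    (h₁ : 0 < NY.μ.mass) (hu : u.1.2 = (NY.μ.mass / NX.μ.mass) • u.1.1)
    {k : Y × Y → ℝ} (hk : Measurable k) {K : ℝ} (hK : ∀ y, |k y| ≤ K) :
    Tendsto (fun i => ∫ p : (X × Y) × (X × Y), k (p.1.2, p.2.2)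
        ∂(((v i).1.1 : Measure (X × Y)).prod (v i).1.1)) l
      (𝓝 (∫ p : (X × Y) × (X × Y), k (p.1.2, p.2.2) ∂((u.1.1 : Measure (X × Y)).prod u.1.1))) := by
  set a : ℝ := (NY.μ.mass : ℝ) / NX.μ.mass with ha
  have ha0 : 0 < a := div_pos (NNReal.coe_pos.2 h₁) (NNReal.coe_pos.2 h₀)
  have hu' : (u.1.2 : Measure (X × Y)) = (NY.μ.mass / NX.μ.mass) • (u.1.1 : Measure (X × Y)) := by
    rw [hu]; rfl
  -- The second marginal of γ₁, not of γ₀, is prescribed. Hence the functional of γ₁ is the same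
  -- number along the family and at the limit, where it equals a² times that of γ₀; total variation
  -- closeness transfers this to γ₀ along the family.
  have hlim := integral_prod_kernel_snd u hk
  rw [hu', integral_prod_smul_smul, NNReal.coe_div, ← ha] at hlim
  have hT : Measurable fun p : (X × Y) × (X × Y) => k (p.1.2, p.2.2) :=
    hk.comp (by fun_prop)
  have b : Tendsto (fun i => |K| * (((NY.μ.mass : ℝ) + NY.μ.mass)
      * (√(hellingerGap (v i).1.1 (v i).1.2) * √(4 * NY.μ.mass)))) l (𝓝 0) := by
    simpa using (((tendsto_sqrt_zero hH).mul_const (√(4 * NY.μ.mass))).const_mul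
      ((NY.μ.mass : ℝ) + NY.μ.mass)).const_mul |K|
  have hb : ∀ i, |a ^ 2 * (∫ p : (X × Y) × (X × Y), k (p.1.2, p.2.2)
          ∂((u.1.1 : Measure (X × Y)).prod u.1.1))
        - a ^ 2 * ∫ p : (X × Y) × (X × Y), k (p.1.2, p.2.2)
          ∂(((v i).1.1 : Measure (X × Y)).prod (v i).1.1)|
      ≤ |K| * (((NY.μ.mass : ℝ) + NY.μ.mass)
        * (√(hellingerGap (v i).1.1 (v i).1.2) * √(4 * NY.μ.mass))) := fun i => by
    have := abs_integral_prod_sub_le_hellingerGap (γ₀ := (v i).1.1) (γ₁ := (v i).1.2)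
      (by rwa [SemiCouplings.mass_fst]) hT (abs_nonneg K)
      (fun z => (hK _).trans (le_abs_self K))
    rw [SemiCouplings.mass_fst, SemiCouplings.mass_snd, integral_prod_kernel_snd _ hk, ← hlim]
      at this
    exact this
  have t := tendsto_zero_of_abs_le hb b
  have t2 := (t.const_mul (-(a ^ 2)⁻¹)).add_const
    (∫ p : (X × Y) × (X × Y), k (p.1.2, p.2.2) ∂((u.1.1 : Measure (X × Y)).prod u.1.1))
  rw [mul_zero, zero_add] at t2
  refine t2.congr fun i => ?_
  field_simp
  ring

/-- Convergence of the quadratic distortion along converging semi-couplings that get close to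
couplings up to a factor; the kernels need not be continuous. -/
theorem tendsto_integral_sq_kernelGap (hv : Tendsto v l (𝓝 u))
    (hH : Tendsto (fun i => hellingerGap (v i).1.1 (v i).1.2) l (𝓝 0)) (h₀ : 0 < NX.μ.mass)
    (h₁ : 0 < NY.μ.mass) (hu : u.1.2 = (NY.μ.mass / NX.μ.mass) • u.1.1) :
    Tendsto (fun i => ∫ p, kernelGap NX.ω NY.ω p ^ 2
        ∂(((v i).1.1 : Measure (X × Y)).prod (v i).1.1)) l
      (𝓝 (∫ p, kernelGap NX.ω NY.ω p ^ 2 ∂((u.1.1 : Measure (X × Y)).prod u.1.1))) := by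
  have hu0 : u.1.1 ≠ 0 := by
    rw [← FiniteMeasure.mass_nonzero_iff, SemiCouplings.mass_fst]
    exact h₀.ne'
  obtain ⟨BX, hBX⟩ := NX.bounded_ω
  obtain ⟨BY, hBY⟩ := NY.bounded_ω
  let j : X × X → ℝ := fun q => NX.ω q.1 q.2
  let k : Y × Y → ℝ := fun q => NY.ω q.1 q.2
  have hj : Measurable j := NX.measurable_ω.coe_nnreal_real
  have hk : Measurable k := NY.measurable_ω.coe_nnreal_real
  have hjB : ∀ q, |j q| ≤ BX := fun q => by
    rw [abs_of_nonneg (NNReal.coe_nonneg _)]; exact_mod_cast hBX _ _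
  have hkB : ∀ q, |k q| ≤ BY := fun q => by
    rw [abs_of_nonneg (NNReal.coe_nonneg _)]; exact_mod_cast hBY _ _
  have hX : ∀ (k : X × X → ℝ) (K : ℝ), Measurable k → (∀ x, |k x| ≤ K) →
      Tendsto (fun i => ∫ p : (X × Y) × (X × Y), k (p.1.1, p.2.1)
        ∂(((v i).1.1 : Measure (X × Y)).prod (v i).1.1)) l
        (𝓝 (∫ p : (X × Y) × (X × Y), k (p.1.1, p.2.1)
          ∂((u.1.1 : Measure (X × Y)).prod u.1.1))) := by
    intro k K hk _
    simp_rw [integral_prod_kernel_fst _ hk]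
    exact tendsto_const_nhds
  have hY := fun (k : Y × Y → ℝ) (K : ℝ) (hk : Measurable k) (hK : ∀ x, |k x| ≤ K) =>
    tendsto_integral_prod_kernel_snd hH h₀ h₁ hu hk hK
  have hjj : ∀ q, |j q ^ 2| ≤ (BX : ℝ) ^ 2 := fun q => by
    rw [abs_pow]; exact pow_le_pow_left₀ (abs_nonneg _) (hjB q) 2
  have hkk : ∀ q, |k q ^ 2| ≤ (BY : ℝ) ^ 2 := fun q => by
    rw [abs_pow]; exact pow_le_pow_left₀ (abs_nonneg _) (hkB q) 2
  have tX := hX (fun q => j q ^ 2) _ (hj.pow_const 2) hjj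
  have tY := hY (fun q => k q ^ 2) _ (hk.pow_const 2) hkk
  have tXY := tendsto_integral_prod_kernel_mul_kernel (tendsto_fst hv) hu0 hX hY hj hjB hk hkB
  -- The pure terms are governed by the marginals alone; only the mixed term sees how γ₀ couples X
  -- and Y.
  have e : ∀ γ : FiniteMeasure (X × Y),
      ∫ p, kernelGap NX.ω NY.ω p ^ 2 ∂((γ : Measure (X × Y)).prod γ)
        = (∫ p : (X × Y) × (X × Y), j (p.1.1, p.2.1) ^ 2 ∂((γ : Measure (X × Y)).prod γ))
          + (∫ p : (X × Y) × (X × Y), k (p.1.2, p.2.2) ^ 2 ∂((γ : Measure (X × Y)).prod γ))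
          - 2 * ∫ p : (X × Y) × (X × Y), j (p.1.1, p.2.1) * k (p.1.2, p.2.2)
            ∂((γ : Measure (X × Y)).prod γ) := by
    intro γ
    have mj : Measurable fun p : (X × Y) × (X × Y) => j (p.1.1, p.2.1) := hj.comp (by fun_prop)
    have mk : Measurable fun p : (X × Y) × (X × Y) => k (p.1.2, p.2.2) := hk.comp (by fun_prop)
    have i1 : Integrable (fun p : (X × Y) × (X × Y) => j (p.1.1, p.2.1) ^ 2)
        ((γ : Measure (X × Y)).prod γ) := integrable_of_abs_le (mj.pow_const 2) fun _ => hjj _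
    have i2 : Integrable (fun p : (X × Y) × (X × Y) => k (p.1.2, p.2.2) ^ 2)
        ((γ : Measure (X × Y)).prod γ) := integrable_of_abs_le (mk.pow_const 2) fun _ => hkk _
    have i3 : Integrable (fun p : (X × Y) × (X × Y) => j (p.1.1, p.2.1) * k (p.1.2, p.2.2))
        ((γ : Measure (X × Y)).prod γ) :=
      integrable_of_abs_le (K := BX * BY) (mj.mul mk) fun p => by
        rw [abs_mul]
        exact mul_le_mul (hjB _) (hkB _) (abs_nonneg _) BX.2
    have hs := integral_sub (i1.add i2) (i3.const_mul 2)
    simp only [Pi.add_apply] at hs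
    rw [← integral_add i1 i2, ← integral_const_mul, ← hs]
    refine integral_congr_ae (Eventually.of_forall fun p => ?_)
    simp only [kernelGap, sq_abs, j, k]
    ring
  simp_rw [e]
  exact (tX.add tY).sub (tXY.const_mul 2)

/-- The lower bound along families with bounded augmented loss. -/
theorem le_of_augmentedLoss_le [NeBot l] {Ω : ℝ → ℝ} (hΩ : IsConeFunction Ω)
    {C C' M a₁ : ℝ} (hC' : 0 ≤ C') (ha₁ : 0 < a₁)
    (hM : ∀ (x x' : X) (y y' : Y), |(NX.ω x x' : ℝ) - (NY.ω y y' : ℝ)| ≤ M)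
    (hupper : ∀ z ∈ Set.Icc (0 : ℝ) (M / a₁), Ω z ≤ 1 - C * z ^ 2 + C' * z ^ 4)
    {δ : ι → ℝ} (hδ : ∀ i, 0 < δ i) (hδl : Tendsto δ l atTop) (hv : Tendsto v l (𝓝 u)) {c : ℝ}
    (hc : ∀ᶠ i in l, augmentedLoss Ω NX NY (δ i) (v i) ≤ c) (h₀ : 0 < NX.μ.mass)
    (h₁ : 0 < NY.μ.mass) :
    2 * C * ((NY.μ.mass : ℝ) / NX.μ.mass) * ∫ p, kernelGap NX.ω NY.ω p ^ 2
      ∂((u.1.1 : Measure (X × Y)).prod u.1.1) ≤ c := by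
  have hH := tendsto_hellingerGap_of_augmentedLoss_le hΩ hδ hδl hc h₀ h₁
  have hu := snd_eq_smul_fst_of_tendsto_hellingerGap hv hH h₀
  have t := (tendsto_integral_sq_kernelGap hv hH h₀ h₁ hu).const_mul
    ((NY.μ.mass : ℝ) / NX.μ.mass)
  set R : ℝ := √NX.μ.mass * √NY.μ.mass + √((NY.μ.mass : ℝ) / NX.μ.mass) * NX.μ.mass
  have b : Tendsto (fun i => M ^ 2 * (R * (√NX.μ.mass * √(hellingerGap (v i).1.1 (v i).1.2)))) l
      (𝓝 0) := by
    simpa using (((tendsto_sqrt_zero hH).const_mul √NX.μ.mass).const_mul R).const_mul (M ^ 2)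
  have hgm := (measurable_kernelGap NX.measurable_ω NY.measurable_ω).pow_const 2
  -- The overlap is L¹-close to √α f₀, so its quadratic form is close to α times that of γ₀.
  have hb : ∀ i, |(∫ p : (X × Y) × (X × Y), kernelGap NX.ω NY.ω p ^ 2
          * (overlap (v i).1.1 (v i).1.2 ((v i).1.1 + (v i).1.2 : Measure (X × Y)) p.1
            * overlap (v i).1.1 (v i).1.2 ((v i).1.1 + (v i).1.2 : Measure (X × Y)) p.2)
          ∂(((v i).1.1 + (v i).1.2 : Measure (X × Y)).prod
            ((v i).1.1 + (v i).1.2 : Measure (X × Y))))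
        - (NY.μ.mass : ℝ) / NX.μ.mass * ∫ p, kernelGap NX.ω NY.ω p ^ 2
          ∂(((v i).1.1 : Measure (X × Y)).prod (v i).1.1)|
      ≤ M ^ 2 * (R * (√NX.μ.mass * √(hellingerGap (v i).1.1 (v i).1.2))) := fun i => by
    have := abs_integral_overlap_sub_le_hellingerGap (γ₀ := (v i).1.1) (γ₁ := (v i).1.2)
      hgm (sq_nonneg M) (abs_sq_kernelGap_le hM)
    rw [SemiCouplings.mass_fst, SemiCouplings.mass_snd] at this
    exact this
  have t' := tendsto_zero_of_abs_le hb b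
  have t2 := t'.add t
  simp only [sub_add_cancel, zero_add] at t2
  have t3 : Tendsto (fun i => C' * M ^ 4 / (2 * δ i ^ 2) * (NX.μ.mass * NY.μ.mass)) l (𝓝 0) := by
    have : Tendsto (fun i => C' * M ^ 4 / (2 * δ i ^ 2)) l (𝓝 0) :=
      Tendsto.div_atTop tendsto_const_nhds
        (((tendsto_pow_atTop two_ne_zero).comp hδl).const_mul_atTop two_pos)
    simpa using this.mul_const ((NX.μ.mass : ℝ) * NY.μ.mass)
  have t4 := (t2.const_mul (2 * C)).sub t3
  rw [sub_zero, ← mul_assoc] at t4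
  refine le_of_tendsto t4 ?_
  filter_upwards [hc, hδl.eventually_ge_atTop a₁] with i hi hia
  have a₀ := absolutelyContinuous_add_left ((v i).1.1 : Measure (X × Y)) (v i).1.2
  have a₁ := absolutelyContinuous_add_right ((v i).1.1 : Measure (X × Y)) (v i).1.2
  have h := le_augmentedLoss_of_upper_bound hΩ (hδ i) hC' ha₁ hM hupper
    (by linarith [hδ i]) (v i) _ a₀ a₁
  rw [SemiCouplings.mass_fst, SemiCouplings.mass_snd] at h
  exact h.trans hi

/-- Without the mass product only minus a nonnegative integral remains. -/
theorem augmentedLoss_nonpos_of_mass_mul_eq_zero {Ω : ℝ → ℝ} (hΩ : IsConeFunction Ω) {δ : ℝ}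
    (hδ : 0 < δ) (γ : SemiCouplings NX.μ NY.μ) (h : (γ.1.1.mass : ℝ) * γ.1.2.mass = 0) :
    augmentedLoss Ω NX NY δ γ ≤ 0 := by
  rw [augmentedLoss_eq hΩ hδ γ _
    (absolutelyContinuous_add_left (γ.1.1 : Measure (X × Y)) γ.1.2)
    (absolutelyContinuous_add_right (γ.1.1 : Measure (X × Y)) γ.1.2), h, zero_sub]
  refine mul_nonpos_of_nonneg_of_nonpos (by positivity) (neg_nonpos.2 (integral_nonneg fun p => ?_))
  exact mul_nonneg (hΩ.mem_unit _ (div_nonneg (kernelGap_nonneg _ _ _) (by positivity))).1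
    (mul_nonneg (overlap_nonneg _ _ _ _) (overlap_nonneg _ _ _ _))

end VariationalConvergence

/-! ### The Γ-convergence -/

theorem theorem4p6 {X Y : Type*}
    [TopologicalSpace X] [CompactSpace X] [PolishSpace X] [MeasurableSpace X] [BorelSpace X]
    [TopologicalSpace Y] [CompactSpace Y] [PolishSpace Y] [MeasurableSpace Y] [BorelSpace Y]
    (NX : MeasureNetwork X) (NY : MeasureNetwork Y)
    (Ω : ℝ → ℝ) (hΩ : IsConeFunction Ω)
    (C C' M a₁ : ℝ) (hC : 0 ≤ C) (hC' : 0 ≤ C') (ha₁ : 0 < a₁)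
    (hM : ∀ (x x' : X) (y y' : Y), |(NX.ω x x' : ℝ) - (NY.ω y y' : ℝ)| ≤ M)
    (hlower : ∀ z : ℝ, 0 ≤ z → 1 - C * z ^ 2 ≤ Ω z)
    (hupper : ∀ z ∈ Set.Icc (0 : ℝ) (M / a₁), Ω z ≤ 1 - C * z ^ 2 + C' * z ^ 4)
    (δ : ℕ → ℝ) (hδ : ∀ n, 0 < δ n) (hδ_lim : Filter.Tendsto δ Filter.atTop Filter.atTop) :
    GammaConverges
      (fun (n : ℕ) (γ : SemiCouplings NX.μ NY.μ) =>
        ((augmentedLoss Ω NX NY (δ n) γ : ℝ) : EReal))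
      (limitLoss C NX NY) := by
  have hpos : ∀ u : SemiCouplings NX.μ NY.μ, ¬(u.1.1 = 0 ∨ u.1.2 = 0) →
      0 < NX.μ.mass ∧ 0 < NY.μ.mass := by
    intro u h
    rw [not_or, ← ne_eq, ← ne_eq, ← FiniteMeasure.mass_nonzero_iff, ← FiniteMeasure.mass_nonzero_iff,
      SemiCouplings.mass_fst, SemiCouplings.mass_snd] at h
    exact ⟨pos_iff_ne_zero.2 h.1, pos_iff_ne_zero.2 h.2⟩
  -- The recovery sequence is constant.
  refine ⟨fun u v hv => ?_, fun u => ⟨fun _ => u, tendsto_const_nhds, ?_⟩⟩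
  · by_cases hz : u.1.1 = 0 ∨ u.1.2 = 0
    · rw [limitLoss, if_pos hz]
      refine le_liminf_of_le (by isBoundedDefault) (Eventually.of_forall fun n => ?_)
      exact EReal.coe_nonneg.2 (augmentedLoss_nonneg hΩ (hδ n) (v n))
    · obtain ⟨h₀, h₁⟩ := hpos u hz
      by_contra! hlt
      obtain ⟨c, hc, hcu⟩ := EReal.lt_iff_exists_real_btwn.1 hlt
      have hfreq := frequently_lt_of_liminf_lt (by isBoundedDefault) hc
      -- Restricting `atTop` to the indices with loss at most c replaces the extraction of a
      -- subsequence; this is why the limit lemmas are stated for a general filter.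
      have hl : NeBot (atTop ⊓ 𝓟 {n | augmentedLoss Ω NX NY (δ n) (v n) ≤ c}) := by
        rw [← frequently_mem_iff_neBot]
        exact hfreq.mono fun n hn => (EReal.coe_lt_coe_iff.1 hn).le
      have hle : ∀ᶠ n in atTop ⊓ 𝓟 {n | augmentedLoss Ω NX NY (δ n) (v n) ≤ c},
          augmentedLoss Ω NX NY (δ n) (v n) ≤ c := mem_inf_of_right (mem_principal_self _)
      have hδl := hδ_lim.mono_left
        (inf_le_left : atTop ⊓ 𝓟 {n | augmentedLoss Ω NX NY (δ n) (v n) ≤ c} ≤ atTop)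
      have hvl := hv.mono_left
        (inf_le_left : atTop ⊓ 𝓟 {n | augmentedLoss Ω NX NY (δ n) (v n) ≤ c} ≤ atTop)
      -- A bounded loss along these indices rules out the infinite branch of the limit functional.
      have hu := snd_eq_smul_fst_of_tendsto_hellingerGap hvl
        (tendsto_hellingerGap_of_augmentedLoss_le hΩ hδ hδl hle h₀ h₁) h₀
      rw [limitLoss, if_neg hz, if_pos hu] at hcu
      exact absurd (le_of_augmentedLoss_le hΩ hC' ha₁ hM hupper hδ hδl hvl hle h₀ h₁)
        (not_le.2 (EReal.coe_lt_coe_iff.1 hcu))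
  · refine limsup_le_of_le (by isBoundedDefault) (Eventually.of_forall fun n => ?_)
    by_cases hz : u.1.1 = 0 ∨ u.1.2 = 0
    · rw [limitLoss, if_pos hz]
      refine EReal.coe_nonpos.2 (augmentedLoss_nonpos_of_mass_mul_eq_zero hΩ (hδ n) u ?_)
      rcases hz with h | h <;> simp [h]
    · obtain ⟨h₀, h₁⟩ := hpos u hz
      by_cases hu : u.1.2 = (NY.μ.mass / NX.μ.mass) • u.1.1
      · rw [limitLoss, if_neg hz, if_pos hu]
        have h := augmentedLoss_le_of_lower_bound hΩ (hδ n) hM hlower u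
          (a := NY.μ.mass / NX.μ.mass)
          (by rw [SemiCouplings.mass_fst, SemiCouplings.mass_snd, div_mul_cancel₀ _ h₀.ne']) hu
        rw [NNReal.coe_div] at h
        exact EReal.coe_le_coe_iff.2 h
      · rw [limitLoss, if_neg hz, if_neg hu]
        exact le_top
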